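/- Let $A\subset\mathbb Z[x]$ be a finite set of nonzero polynomials all of whose complex roots are real. Consider the Borel probability measures $\nu$ on $[0,\infty)$ that satisfy $$I(\nu):=\iint \log|x-y|\,d\nu(x)\,d\nu(y)\ \ge 0\qquad\text{and}\qquad \int\log|Q(x)|\,d\nu(x)\ge 0\ \text{ for every } Q\in A$$ (where $\log 0=-\infty$), and let $\mu_A$ be an optimal solution, that is, a measure which minimizes $\int x\,d\nu(x)$ among all of these $\nu$. Then the support $\Sigma$ of $\mu_A$ is a finite union of compact intervals: there are an integer $l\ge 0$ and real numbers $a_0<a_1<\dots<a_{2l+1}$ with $$\Sigma=\bigcup_{i=0}^{l}[a_{2i},a_{2i+1}],$$ and every gap interval $(a_{2i+1},a_{2i+2})$, $0\le i<l$, contains a root of some $Q\in A$. -/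

import Mathlib

open MeasureTheory
open scoped ENNReal

namespace TraceProblem

/-- The logarithm `log |t|` of a real number, with the value `-∞` at `t = 0`. -/
noncomputable def logAbs (t : ℝ) : EReal := ENNReal.log ‖t‖ₑ

/-- The integral `∫ f dμ = ∫ f⁺ dμ - ∫ f⁻ dμ` of an extended-real-valued function. It takes values
in `[-∞, ∞]`; the undefined case `∞ - ∞` is given the value `-∞`. -/
noncomputable def extIntegral {α : Type*} [MeasurableSpace α] (μ : Measure α) (f : α → EReal) :
    EReal :=
  ((∫⁻ x, (f x).toENNReal ∂μ : ℝ≥0∞) : EReal) - ((∫⁻ x, (-f x).toENNReal ∂μ : ℝ≥0∞) : EReal)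

/-- The logarithmic energy `I(μ) = ∬ log |x - y| dμ(x) dμ(y)`. -/
noncomputable def logEnergy (μ : Measure ℝ) : EReal :=
  extIntegral (μ.prod μ) fun p => logAbs (p.1 - p.2)

/-- The integral `∫ log |Q(x)| dμ(x)`. -/
noncomputable def logIntegral (μ : Measure ℝ) (Q : Polynomial ℤ) : EReal :=
  extIntegral μ fun x => logAbs (Polynomial.aeval x Q)

/-- The expectation `∫ x dμ(x) ∈ [0, ∞]` of a measure carried by `[0, ∞)`. -/
noncomputable def mean (μ : Measure ℝ) : ℝ≥0∞ := ∫⁻ x, ENNReal.ofReal x ∂μ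

/-- The constraints of the primal problem: `μ` is a Borel probability measure on `[0, ∞)` with
`I(μ) ≥ 0` and `∫ log |Q| dμ ≥ 0` for every `Q ∈ A`. -/
structure IsFeasible (A : Finset (Polynomial ℤ)) (μ : Measure ℝ) : Prop where
  prob : IsProbabilityMeasure μ
  nonneg : μ (Set.Iio 0) = 0
  energy : 0 ≤ logEnergy μ
  logs : ∀ Q ∈ A, 0 ≤ logIntegral μ Q

/-- `μ` is an optimal solution of the primal problem: it is feasible and has the least
expectation among all feasible measures. -/
def IsOptimal (A : Finset (Polynomial ℤ)) (μ : Measure ℝ) : Prop :=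
  IsFeasible A μ ∧ ∀ ν : Measure ℝ, IsFeasible A ν → mean μ ≤ mean ν

/-- All complex roots of `Q` are real (in particular `Q ≠ 0`). -/
def HasOnlyRealRoots (Q : Polynomial ℤ) : Prop :=
  ∀ z : ℂ, Polynomial.aeval z Q = 0 → z.im = 0

end TraceProblem

open MeasureTheory
open scoped ENNReal NNReal

namespace TraceProblem

/-! The argument is variational. Suppose that a part `τ` of `μ`, bounded by a multiple of `μ`, is
replaced in a small proportion `t` by a measure `ρ` of the same mass. The energy changes by
`2t(I(μ,ρ) - I(μ,τ)) + O(t²)`, while the mean and the integrals of `log |Q|` change linearly. So if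
`ρ` has smaller mean, larger mutual energy with `μ`, and no smaller integral of `log |x - r|` for
each root `r`, then `μ` was not optimal (`IsOptimal.not_improvable`). Both uses take `ρ` to be a
multiple of a uniform measure.

Bounded support (`IsOptimal.exists_measure_Ioi_eq_zero`): mass far out costs a lot of mean but gains
only logarithmically, so it can profitably be moved to a long interval `[0, L]` whose potential is
large everywhere.

Gaps (`IsOptimal.exists_root_of_gap`): if `a < b` lie in the support and `(a, b)` contains neither
mass nor a root, then `log |x - y|` is concave in `x` across the gap for each `y` in the support or
the root set. Moving mass from near `a` and near `b` to near the midpoint raises all the logarithmic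
integrals, and placing it slightly left of the midpoint lowers the mean. Real-rootedness enters
here: every pole lies on the line, outside the gap.

Finite energy excludes atoms, so the support has no isolated points. A compact set without isolated
points, each of whose gaps meets a fixed finite set, is a finite union of nondegenerate intervals
(`exists_eq_iUnion_Icc`). -/

lemma logAbs_zero : logAbs 0 = ⊥ := by simp [logAbs]

lemma logAbs_of_ne_zero {t : ℝ} (ht : t ≠ 0) : logAbs t = (Real.log t : EReal) := by
  rw [logAbs, Real.enorm_eq_ofReal_abs, ENNReal.log_ofReal_of_pos (abs_pos.2 ht), Real.log_abs]

lemma measurable_logAbs : Measurable logAbs :=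
  ENNReal.measurable_log.comp measurable_enorm

/-! ### Extended-real logarithmic integrals and absolute convergence -/

section ExtIntegral

variable {α : Type*} [MeasurableSpace α] {μ : Measure α} {g : α → ℝ}

lemma lintegral_logAbs (hg0 : ∀ᵐ x ∂μ, g x ≠ 0) :
    ∫⁻ x, (logAbs (g x)).toENNReal ∂μ = ∫⁻ x, ENNReal.ofReal (Real.log (g x)) ∂μ := by
  refine lintegral_congr_ae ?_
  filter_upwards [hg0] with x hx
  rw [logAbs_of_ne_zero hx, EReal.real_coe_toENNReal]

lemma lintegral_neg_logAbs (hg0 : ∀ᵐ x ∂μ, g x ≠ 0) :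
    ∫⁻ x, (-logAbs (g x)).toENNReal ∂μ = ∫⁻ x, ENNReal.ofReal (-Real.log (g x)) ∂μ := by
  refine lintegral_congr_ae ?_
  filter_upwards [hg0] with x hx
  rw [logAbs_of_ne_zero hx, ← EReal.coe_neg, EReal.real_coe_toENNReal]

lemma extIntegral_logAbs (hg0 : ∀ᵐ x ∂μ, g x ≠ 0) (hi : Integrable (fun x => Real.log (g x)) μ) :
    extIntegral μ (fun x => logAbs (g x)) = ((∫ x, Real.log (g x) ∂μ : ℝ) : EReal) := by
  have h1 : ∫⁻ x, ENNReal.ofReal (Real.log (g x)) ∂μ ≠ ⊤ := hi.lintegral_lt_top.ne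
  have h2 : ∫⁻ x, ENNReal.ofReal (-Real.log (g x)) ∂μ ≠ ⊤ := hi.neg.lintegral_lt_top.ne
  rw [extIntegral, lintegral_logAbs hg0, lintegral_neg_logAbs hg0,
    integral_eq_lintegral_pos_part_sub_lintegral_neg_part hi, EReal.coe_sub,
    EReal.coe_ennreal_toReal h1, EReal.coe_ennreal_toReal h2]

lemma integrable_log_of_extIntegral_nonneg (hg : Measurable g) {b : α → ℝ} (hb : Integrable b μ)
    (hgb : ∀ᵐ x ∂μ, Real.log (g x) ≤ b x)
    (h : 0 ≤ extIntegral μ (fun x => logAbs (g x))) :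
    (∀ᵐ x ∂μ, g x ≠ 0) ∧ Integrable (fun x => Real.log (g x)) μ := by
  have hpos : ∫⁻ x, (logAbs (g x)).toENNReal ∂μ ≠ ⊤ := by
    refine ((lintegral_mono_ae ?_).trans_lt hb.lintegral_lt_top).ne
    filter_upwards [hgb] with x hx
    by_cases h0 : g x = 0
    · simp [h0, logAbs_zero]
    · rw [logAbs_of_ne_zero h0, EReal.real_coe_toENNReal]
      exact ENNReal.ofReal_le_ofReal hx
  -- An infinite negative part gives the value `-∞` whatever the positive part is, by the convention
  -- for `∞ - ∞`.
  have hneg : ∫⁻ x, (-logAbs (g x)).toENNReal ∂μ ≠ ⊤ := by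
    intro htop
    rw [extIntegral, htop] at h
    simp at h
  have hm : Measurable fun x => (-logAbs (g x)).toENNReal :=
    (measurable_logAbs.comp hg).neg.ereal_toENNReal
  have hne : ∀ᵐ x ∂μ, g x ≠ 0 := by
    filter_upwards [ae_lt_top hm hneg] with x hx h0
    simp [h0, logAbs_zero] at hx
  refine ⟨hne, ?_⟩
  rw [lintegral_logAbs hne] at hpos
  rw [lintegral_neg_logAbs hne] at hneg
  have hml : Measurable fun x => Real.log (g x) := Real.measurable_log.comp hg
  refine ⟨hml.aestronglyMeasurable, ?_⟩
  rw [hasFiniteIntegral_iff_norm]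
  calc ∫⁻ x, ENNReal.ofReal ‖Real.log (g x)‖ ∂μ
      ≤ ∫⁻ x, (ENNReal.ofReal (Real.log (g x)) + ENNReal.ofReal (-Real.log (g x))) ∂μ := by
        refine lintegral_mono fun x => ?_
        rw [Real.norm_eq_abs]
        rcases abs_cases (Real.log (g x)) with h | h <;> rw [h.1]
        · exact le_self_add
        · exact le_add_self
    _ < ⊤ := by
        rw [lintegral_add_left (by fun_prop)]
        exact ENNReal.add_lt_top.2 ⟨hpos.lt_top, hneg.lt_top⟩

end ExtIntegral

/-! ### The diagonal, growth of the logarithm, and factorization over the real roots -/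

lemma ae_sub_ne_zero {μ ν : Measure ℝ} [SFinite ν] [NullSingletonClass ν] :
    ∀ᵐ p ∂(μ.prod ν), p.1 - p.2 ≠ 0 := by
  have hm : MeasurableSet {p : ℝ × ℝ | p.1 - p.2 ≠ 0} :=
    (measurableSet_singleton (0 : ℝ)).compl.preimage (measurable_fst.sub measurable_snd)
  rw [Measure.ae_prod_iff_ae_ae hm]
  refine Filter.Eventually.of_forall fun x => ?_
  filter_upwards [Measure.ae_ne ν x] with y hy
  exact sub_ne_zero.2 hy.symm

/-- An atom of `μ` would give the diagonal positive `μ.prod μ`-mass. -/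
lemma nullSingletonClass_of_ae_sub_ne_zero {μ : Measure ℝ} [SFinite μ]
    (h : ∀ᵐ p ∂(μ.prod μ), p.1 - p.2 ≠ 0) : NullSingletonClass μ := by
  refine ⟨fun x => ?_⟩
  have h0 : (μ.prod μ) ({x} ×ˢ {x}) = 0 := by
    refine measure_mono_null ?_ (ae_iff.1 h)
    rintro ⟨a, b⟩ ⟨ha, hb⟩
    simp_all
  rw [Measure.prod_prod] at h0
  exact mul_self_eq_zero.1 h0

lemma log_sub_le (x y : ℝ) : Real.log (x - y) ≤ Real.log (1 + |x|) + Real.log (1 + |y|) := by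
  have hx : 0 ≤ |x| := abs_nonneg x
  have hy : 0 ≤ |y| := abs_nonneg y
  rw [← Real.log_mul (by positivity) (by positivity), ← Real.log_abs (x - y)]
  rcases eq_or_ne (x - y) 0 with h | h
  · rw [h, abs_zero, Real.log_zero]
    exact Real.log_nonneg (by nlinarith)
  · refine Real.log_le_log (abs_pos.2 h) ?_
    have := abs_sub x y
    nlinarith

lemma log_one_add_abs_nonneg (x : ℝ) : 0 ≤ Real.log (1 + |x|) :=
  Real.log_nonneg (by have := abs_nonneg x; linarith)

lemma log_one_add_abs_le (x : ℝ) : Real.log (1 + |x|) ≤ |x| := by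
  have := Real.log_le_sub_one_of_pos (show 0 < 1 + |x| by positivity)
  linarith

lemma integrable_log_one_add_abs {μ : Measure ℝ} (h : Integrable (fun x : ℝ => x) μ) :
    Integrable (fun x : ℝ => Real.log (1 + |x|)) μ := by
  refine h.abs.mono' (Real.measurable_log.comp (by fun_prop)).aestronglyMeasurable
    (Filter.Eventually.of_forall fun x => ?_)
  rw [Real.norm_eq_abs, abs_of_nonneg (log_one_add_abs_nonneg x)]
  exact log_one_add_abs_le x

/-- Over the reals, `log |Q|` is a sum of translates of `log |x|`. -/
lemma HasOnlyRealRoots.exists_log_eq {Q : Polynomial ℤ} (hQ : HasOnlyRealRoots Q) :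
    ∃ (S : Finset ℝ) (n : ℝ → ℕ) (c : ℝ), 0 ≤ c ∧
      (∀ r, r ∈ S ↔ Polynomial.aeval r Q = 0) ∧ (∀ r ∈ S, 1 ≤ n r) ∧
      ∀ x ∉ S, Real.log (Polynomial.aeval x Q) = c + ∑ r ∈ S, n r * Real.log (x - r) := by
  classical
  have hQ0 : Q ≠ 0 := by
    rintro rfl
    simpa using hQ Complex.I (by simp)
  set P : Polynomial ℂ := Q.map (Int.castRingHom ℂ) with hP
  have hP0 : P ≠ 0 := (Polynomial.map_ne_zero_iff (RingHom.injective_int _)).2 hQ0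
  have hev : ∀ z : ℂ, P.eval z = Polynomial.aeval z Q := fun z => by
    rw [hP, Polynomial.eval_map, Polynomial.aeval_def]; rfl
  have hsplit : P = Polynomial.C P.leadingCoeff *
      (P.roots.map fun a => Polynomial.X - Polynomial.C a).prod :=
    (IsAlgClosed.splits P).eq_prod_roots
  have hcoe : ∀ x : ℝ, ((Polynomial.aeval x Q : ℝ) : ℂ) = Polynomial.aeval (x : ℂ) Q := fun x => by
    exact (Polynomial.aeval_algebraMap_apply ℂ x Q).symm
  set s : Multiset ℝ := P.roots.map Complex.re with hs
  have hre : ∀ z ∈ P.roots, ((z.re : ℝ) : ℂ) = z := fun z hz => by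
    have := hQ z (by rw [← hev]; exact (Polynomial.mem_roots hP0).1 hz)
    apply Complex.ext <;> simp [this]
  have hfac : ∀ x : ℝ, |Polynomial.aeval x Q|
      = |(Q.leadingCoeff : ℝ)| * (s.map fun r => |x - r|).prod := by
    intro x
    have h1 : ‖((Polynomial.aeval x Q : ℝ) : ℂ)‖ = |Polynomial.aeval x Q| := by
      rw [Complex.norm_real, Real.norm_eq_abs]
    rw [← h1, hcoe, ← hev]
    conv_lhs => rw [hsplit]
    rw [Polynomial.eval_mul, Polynomial.eval_C, norm_mul, Polynomial.eval_multiset_prod,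
      Multiset.map_map]
    congr 1
    · rw [hP, Polynomial.leadingCoeff_map_of_injective (RingHom.injective_int _)]
      simp
    · rw [hs, Multiset.map_map, ← normHom_apply, map_multiset_prod, Multiset.map_map]
      congr 1
      refine Multiset.map_congr rfl fun z hz => ?_
      simp only [Function.comp, Polynomial.eval_sub, Polynomial.eval_X, Polynomial.eval_C,
        normHom_apply]
      conv_lhs => rw [← hre z hz, ← Complex.ofReal_sub, Complex.norm_real, Real.norm_eq_abs]
  -- Integrality is used here: a nonzero integer leading coefficient makes the constant `c`
  -- nonnegative.
  have hlc : (1 : ℝ) ≤ |(Q.leadingCoeff : ℝ)| := by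
    rw [← Int.cast_abs]
    exact_mod_cast Int.one_le_abs (Polynomial.leadingCoeff_ne_zero.2 hQ0)
  have hroot : ∀ r, r ∈ s.toFinset ↔ Polynomial.aeval r Q = 0 := by
    intro r
    rw [← abs_eq_zero, hfac, mul_eq_zero, Multiset.mem_toFinset, Multiset.prod_eq_zero_iff]
    simp only [Multiset.mem_map]
    constructor
    · exact fun h => Or.inr ⟨r, h, by simp⟩
    · rintro (h | ⟨a, ha, h⟩)
      · linarith
      · rw [abs_eq_zero, sub_eq_zero] at h
        exact h ▸ ha
  refine ⟨s.toFinset, fun r => s.count r, Real.log |(Q.leadingCoeff : ℝ)|, Real.log_nonneg hlc,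
    hroot, fun r hr => Multiset.one_le_count_iff_mem.2 (Multiset.mem_toFinset.1 hr), fun x hx => ?_⟩
  rw [← Real.log_abs, hfac, Finset.prod_multiset_map_count, Real.log_mul (by linarith),
    Real.log_prod]
  · congr 1
    refine Finset.sum_congr rfl fun r _ => ?_
    rw [Real.log_pow, Real.log_abs]
  · intro r hr
    have : x ≠ r := fun h => hx (h ▸ hr)
    exact pow_ne_zero _ (abs_ne_zero.2 (sub_ne_zero.2 this))
  · refine Finset.prod_ne_zero_iff.2 fun r hr => ?_
    have : x ≠ r := fun h => hx (h ▸ hr)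
    exact pow_ne_zero _ (abs_ne_zero.2 (sub_ne_zero.2 this))

/-! ### Logarithmic potentials of uniform measures -/

/-- The function `|log u|` cut off outside of `[-1, 1]`. -/
noncomputable def nearLog : ℝ → ℝ := (Set.Icc (-1) 1).indicator fun u => |Real.log u|

lemma nearLog_nonneg (u : ℝ) : 0 ≤ nearLog u := Set.indicator_nonneg (fun _ _ => abs_nonneg _) u

lemma integrable_nearLog : Integrable nearLog := by
  rw [nearLog, integrable_indicator_iff measurableSet_Icc]
  have h := (intervalIntegral.intervalIntegrable_log' (a := -1) (b := 1)).abs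
  rwa [intervalIntegrable_iff_integrableOn_Icc_of_le (by norm_num)] at h

lemma abs_log_le (u : ℝ) : |Real.log u| ≤ nearLog u + |u| := by
  rcases le_or_gt |u| 1 with h | h
  · rw [nearLog, Set.indicator_of_mem (Set.mem_Icc.2 (abs_le.1 h))]
    linarith [abs_nonneg u]
  · rw [← Real.log_abs u, abs_of_nonneg (Real.log_nonneg h.le)]
    linarith [nearLog_nonneg u, Real.log_le_sub_one_of_pos (show 0 < |u| by linarith)]

/-- Both subtracted functions are integrable over the whole line, so after translation they cost a
bounded amount on an interval of any length, wherever the pole is. -/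
lemma le_log {M : ℝ} (hM : 1 ≤ M) (u : ℝ) :
    Real.log M - nearLog u - (Set.Icc (-M) M).indicator (fun _ => Real.log M) u ≤ Real.log u := by
  have h0 := Real.log_nonneg hM
  rcases le_or_gt |u| M with h | h
  · rw [Set.indicator_of_mem (Set.mem_Icc.2 (abs_le.1 h))]
    rcases le_or_gt |u| 1 with h1 | h1
    · rw [nearLog, Set.indicator_of_mem (Set.mem_Icc.2 (abs_le.1 h1))]
      linarith [neg_abs_le (Real.log u)]
    · have := Real.log_nonneg h1.le
      rw [Real.log_abs] at this
      linarith [nearLog_nonneg u]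
  · rw [Set.indicator_of_notMem (fun h' => h.not_ge (abs_le.2 (Set.mem_Icc.1 h')))]
    have := Real.log_le_log (by linarith) h.le
    rw [Real.log_abs] at this
    linarith [nearLog_nonneg u]

/-- The uniform probability measure on `[p, q]`. -/
noncomputable def unif (p q : ℝ) : Measure ℝ := ProbabilityTheory.cond volume (Set.Icc p q)

section Unif

variable {p q : ℝ}

lemma isProbabilityMeasure_unif (h : p < q) : IsProbabilityMeasure (unif p q) :=
  ProbabilityTheory.cond_isProbabilityMeasure_of_finite (by simp [h]) (by simp)

instance : NullSingletonClass (unif p q) :=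
  ⟨fun x => by simp [unif, ProbabilityTheory.cond]⟩

lemma integral_unif (h : p < q) (f : ℝ → ℝ) :
    ∫ x, f x ∂(unif p q) = (q - p)⁻¹ * ∫ x in Set.Icc p q, f x := by
  rw [unif, ProbabilityTheory.cond, integral_smul_measure, Real.volume_Icc, ENNReal.toReal_inv,
    ENNReal.toReal_ofReal (by linarith), smul_eq_mul]

lemma integrable_unif (h : p < q) {f : ℝ → ℝ} (hf : IntegrableOn f (Set.Icc p q)) :
    Integrable f (unif p q) :=
  hf.smul_measure (by simp [h])

lemma ae_unif : ∀ᵐ x ∂(unif p q), x ∈ Set.Icc p q :=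
  ProbabilityTheory.ae_cond_mem measurableSet_Icc

lemma integrable_id_unif (h : p < q) : Integrable (fun x : ℝ => x) (unif p q) :=
  integrable_unif h (continuous_id.integrableOn_Icc)

lemma integral_id_unif_le (h : p < q) : ∫ x, x ∂(unif p q) ≤ q := by
  have := isProbabilityMeasure_unif h
  calc ∫ x, x ∂(unif p q) ≤ ∫ x, q ∂(unif p q) :=
        integral_mono_ae (integrable_id_unif h) (integrable_const q)
          (by filter_upwards [ae_unif] with x hx using hx.2)
    _ = q := by simp

lemma integrable_nearLog_sub (x : ℝ) : Integrable fun y => nearLog (x - y) :=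
  integrable_nearLog.comp_sub_left x

lemma integrableOn_log_sub (x : ℝ) : IntegrableOn (fun y => Real.log (x - y)) (Set.Icc p q) := by
  have hb : IntegrableOn (fun y => nearLog (x - y) + |x - y|) (Set.Icc p q) :=
    (integrable_nearLog_sub x).integrableOn.add
      (Continuous.integrableOn_Icc (by fun_prop))
  refine hb.mono' (Real.measurable_log.comp (by fun_prop)).aestronglyMeasurable ?_
  exact Filter.Eventually.of_forall fun y => by
    rw [Real.norm_eq_abs]
    exact abs_log_le _

lemma integrable_log_sub_unif (h : p < q) (x : ℝ) :
    Integrable (fun y => Real.log (x - y)) (unif p q) :=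
  integrable_unif h (integrableOn_log_sub x)

/-- The bound grows linearly in `|x|`, hence is integrable against every finite measure with a first
moment. -/
lemma integral_abs_log_sub_unif_le (h : p < q) (x : ℝ) :
    ∫ y, |Real.log (x - y)| ∂(unif p q) ≤ (q - p)⁻¹ * (∫ u, nearLog u) + (|x| + (|p| + |q|)) := by
  have := isProbabilityMeasure_unif h
  have h1 : Integrable (fun y => nearLog (x - y)) (unif p q) :=
    integrable_unif h (integrable_nearLog_sub x).integrableOn
  calc ∫ y, |Real.log (x - y)| ∂(unif p q)
      ≤ ∫ y, (nearLog (x - y) + (|x| + (|p| + |q|))) ∂(unif p q) := by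
        refine integral_mono_ae (integrable_log_sub_unif h x).abs
          (h1.add (integrable_const _)) ?_
        filter_upwards [ae_unif] with y hy
        have h2 := abs_sub x y
        have h3 := abs_log_le (x - y)
        have h4 : |y| ≤ |p| + |q| := by
          rw [abs_le]
          constructor
          · linarith [hy.1, neg_abs_le p, abs_nonneg q]
          · linarith [hy.2, le_abs_self q, abs_nonneg p]
        linarith
    _ = (q - p)⁻¹ * (∫ y in Set.Icc p q, nearLog (x - y)) + (|x| + (|p| + |q|)) := by
        rw [integral_add h1 (integrable_const _), integral_unif h]
        simp
    _ ≤ _ := by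
        have h5 : ∫ y in Set.Icc p q, nearLog (x - y) ≤ ∫ y, nearLog (x - y) :=
          setIntegral_le_integral (integrable_nearLog_sub x)
            (Filter.Eventually.of_forall fun y => nearLog_nonneg _)
        rw [integral_sub_left_eq_self nearLog volume x] at h5
        have : 0 < (q - p)⁻¹ := inv_pos.2 (by linarith)
        gcongr

lemma measurable_log_sub : Measurable fun z : ℝ × ℝ => Real.log (z.1 - z.2) :=
  Real.measurable_log.comp (measurable_fst.sub measurable_snd)

lemma integrable_log_prod_unif (h : p < q) {μ : Measure ℝ} [IsFiniteMeasure μ]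
    (hμ : Integrable (fun x : ℝ => x) μ) :
    Integrable (fun z : ℝ × ℝ => Real.log (z.1 - z.2)) (μ.prod (unif p q)) := by
  have := isProbabilityMeasure_unif h
  rw [integrable_prod_iff measurable_log_sub.aestronglyMeasurable]
  refine ⟨Filter.Eventually.of_forall fun x => integrable_log_sub_unif h x, ?_⟩
  have hb : Integrable (fun x => (q - p)⁻¹ * (∫ u, nearLog u) + (|x| + (|p| + |q|))) μ :=
    (integrable_const _).add (hμ.abs.add (integrable_const _))
  refine hb.mono' (measurable_log_sub.norm.stronglyMeasurable.integral_prod_right'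
    (ν := unif p q)).aestronglyMeasurable (Filter.Eventually.of_forall fun x => ?_)
  rw [Real.norm_of_nonneg (integral_nonneg fun y => norm_nonneg _)]
  exact integral_abs_log_sub_unif_le h x

/-- On `[0, L]` the bound `le_log` loses at most `D = ∫ nearLog + 2 M log M` in total, uniformly in
`x`. With `L = D + 1` the average is at least `log M - 1`. -/
lemma exists_le_integral_log_unif (N : ℝ) :
    ∃ L, 0 < L ∧ ∀ x, N ≤ ∫ y, Real.log (x - y) ∂(unif 0 L) := by
  obtain ⟨M, hM1, hMN⟩ : ∃ M : ℝ, 1 ≤ M ∧ N + 1 ≤ Real.log M := by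
    refine ⟨Real.exp (max 0 (N + 1)), Real.one_le_exp (le_max_left _ _), ?_⟩
    rw [Real.log_exp]
    exact le_max_right _ _
  have hlM := Real.log_nonneg hM1
  set G := ∫ u, nearLog u with hG
  have hG0 : 0 ≤ G := integral_nonneg nearLog_nonneg
  set D := G + 2 * M * Real.log M with hD
  have hD0 : 0 ≤ D := by positivity
  refine ⟨D + 1, by positivity, fun x => ?_⟩
  have hL : (0 : ℝ) < D + 1 := by positivity
  set T : ℝ → ℝ := (Set.Icc (-M) M).indicator fun _ => Real.log M with hT
  have hTi : Integrable T := by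
    rw [hT, integrable_indicator_iff measurableSet_Icc]
    exact continuous_const.integrableOn_Icc
  have hTx : Integrable fun y => T (x - y) := hTi.comp_sub_left x
  have hTint : ∫ y in Set.Icc 0 (D + 1), T (x - y) ≤ 2 * M * Real.log M := by
    calc ∫ y in Set.Icc 0 (D + 1), T (x - y) ≤ ∫ y, T (x - y) :=
          setIntegral_le_integral hTx (Filter.Eventually.of_forall fun y =>
            Set.indicator_nonneg (fun _ _ => hlM) _)
      _ = ∫ y, T y := integral_sub_left_eq_self T volume x
      _ = 2 * M * Real.log M := by
          rw [hT, integral_indicator measurableSet_Icc, setIntegral_const, Real.volume_real_Icc,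
            max_eq_left (by linarith), smul_eq_mul]
          ring
  have hnint : ∫ y in Set.Icc 0 (D + 1), nearLog (x - y) ≤ G := by
    have h5 : ∫ y in Set.Icc 0 (D + 1), nearLog (x - y) ≤ ∫ y, nearLog (x - y) :=
      setIntegral_le_integral (integrable_nearLog_sub x)
        (Filter.Eventually.of_forall fun y => nearLog_nonneg _)
    rwa [integral_sub_left_eq_self nearLog volume x] at h5
  have hmain : (D + 1) * Real.log M - G - 2 * M * Real.log M
      ≤ ∫ y in Set.Icc 0 (D + 1), Real.log (x - y) := by
    have hc : IntegrableOn (fun _ : ℝ => Real.log M) (Set.Icc 0 (D + 1)) :=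
      continuous_const.integrableOn_Icc
    have hn := (integrable_nearLog_sub x).integrableOn (s := Set.Icc 0 (D + 1))
    have ht := hTx.integrableOn (s := Set.Icc 0 (D + 1))
    have hcn : IntegrableOn (fun y => Real.log M - nearLog (x - y)) (Set.Icc 0 (D + 1)) :=
      hc.sub hn
    calc (D + 1) * Real.log M - G - 2 * M * Real.log M
        ≤ (D + 1) * Real.log M - (∫ y in Set.Icc 0 (D + 1), nearLog (x - y))
          - ∫ y in Set.Icc 0 (D + 1), T (x - y) := by linarith
      _ = ∫ y in Set.Icc 0 (D + 1), (Real.log M - nearLog (x - y) - T (x - y)) := by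
          have e : (D + 1) * Real.log M = ∫ y in Set.Icc 0 (D + 1), Real.log M := by
            rw [setIntegral_const, Real.volume_real_Icc, max_eq_left (by linarith), smul_eq_mul]
            ring
          rw [integral_sub hcn ht, integral_sub hc hn, e]
      _ ≤ _ := setIntegral_mono (hcn.sub ht) (integrableOn_log_sub x)
          fun y => le_log hM1 (x - y)
  rw [integral_unif hL, sub_zero, ← div_eq_inv_mul, le_div_iff₀ hL]
  nlinarith

end Unif

/-! ### Integrals of `log |Q|` in terms of the roots -/

lemma log_sub_comm (x y : ℝ) : Real.log (x - y) = Real.log (y - x) := by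
  rw [← Real.log_abs, abs_sub_comm, Real.log_abs]

lemma measurable_aeval (Q : Polynomial ℤ) : Measurable fun x : ℝ => Polynomial.aeval x Q :=
  (Polynomial.continuous_aeval Q).measurable

lemma ae_notMem_finset (μ : Measure ℝ) [NullSingletonClass μ] (S : Finset ℝ) :
    ∀ᵐ x ∂μ, x ∉ S :=
  compl_mem_ae_iff.2 (S.finite_toSet.measure_zero μ)

section Roots

variable {Q : Polynomial ℤ} {μ : Measure ℝ} [IsFiniteMeasure μ] [NullSingletonClass μ]

lemma HasOnlyRealRoots.integrable_log (hQ : HasOnlyRealRoots Q)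
    (h : ∀ r, Polynomial.aeval r Q = 0 → Integrable (fun x => Real.log (x - r)) μ) :
    Integrable (fun x => Real.log (Polynomial.aeval x Q)) μ := by
  obtain ⟨S, n, c, -, hS, -, hlog⟩ := hQ.exists_log_eq
  have hi : Integrable (fun x => c + ∑ r ∈ S, n r * Real.log (x - r)) μ :=
    (integrable_const c).add (integrable_finsetSum S fun r hr => (h r ((hS r).1 hr)).const_mul _)
  refine hi.congr ?_
  filter_upwards [ae_notMem_finset μ S] with x hx
  rw [hlog x hx]

lemma HasOnlyRealRoots.integral_log_nonneg [IsProbabilityMeasure μ] (hQ : HasOnlyRealRoots Q)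
    (h : ∀ r, Polynomial.aeval r Q = 0 → Integrable (fun x => Real.log (x - r)) μ)
    (h0 : ∀ r, Polynomial.aeval r Q = 0 → 0 ≤ ∫ x, Real.log (x - r) ∂μ) :
    0 ≤ ∫ x, Real.log (Polynomial.aeval x Q) ∂μ := by
  obtain ⟨S, n, c, hc, hS, -, hlog⟩ := hQ.exists_log_eq
  have hi : ∀ r ∈ S, Integrable (fun x => n r * Real.log (x - r)) μ :=
    fun r hr => (h r ((hS r).1 hr)).const_mul _
  have e : ∫ x, Real.log (Polynomial.aeval x Q) ∂μ
      = c + ∑ r ∈ S, n r * ∫ x, Real.log (x - r) ∂μ := by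
    calc _ = ∫ x, (c + ∑ r ∈ S, n r * Real.log (x - r)) ∂μ := by
          refine integral_congr_ae ?_
          filter_upwards [ae_notMem_finset μ S] with x hx
          rw [hlog x hx]
      _ = _ := by
          rw [integral_add (integrable_const c) (integrable_finsetSum S hi),
            integral_finsetSum S hi]
          simp [integral_const_mul]
  rw [e]
  exact add_nonneg hc (Finset.sum_nonneg fun r hr =>
    mul_nonneg (Nat.cast_nonneg _) (h0 r ((hS r).1 hr)))

/-- Reduces the constraint for `Q` to its individual roots; equal total mass makes the contributions
of the constant `c` agree. -/
lemma HasOnlyRealRoots.integral_log_mono {ν : Measure ℝ} [IsFiniteMeasure ν]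
    [NullSingletonClass ν] (hQ : HasOnlyRealRoots Q) (hmass : μ.real Set.univ = ν.real Set.univ)
    (hμ : ∀ r, Polynomial.aeval r Q = 0 → Integrable (fun x => Real.log (x - r)) μ)
    (hν : ∀ r, Polynomial.aeval r Q = 0 → Integrable (fun x => Real.log (x - r)) ν)
    (h : ∀ r, Polynomial.aeval r Q = 0 →
      ∫ x, Real.log (x - r) ∂μ ≤ ∫ x, Real.log (x - r) ∂ν) :
    ∫ x, Real.log (Polynomial.aeval x Q) ∂μ ≤ ∫ x, Real.log (Polynomial.aeval x Q) ∂ν := by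
  obtain ⟨S, n, c, hc, hS, -, hlog⟩ := hQ.exists_log_eq
  have e : ∀ (α : Measure ℝ) [IsFiniteMeasure α] [NullSingletonClass α],
      (∀ r, Polynomial.aeval r Q = 0 → Integrable (fun x => Real.log (x - r)) α) →
      ∫ x, Real.log (Polynomial.aeval x Q) ∂α
        = α.real Set.univ * c + ∑ r ∈ S, n r * ∫ x, Real.log (x - r) ∂α := by
    intro α _ _ hα
    have hi : ∀ r ∈ S, Integrable (fun x => n r * Real.log (x - r)) α :=
      fun r hr => (hα r ((hS r).1 hr)).const_mul _
    calc _ = ∫ x, (c + ∑ r ∈ S, n r * Real.log (x - r)) ∂α := by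
          refine integral_congr_ae ?_
          filter_upwards [ae_notMem_finset α S] with x hx
          rw [hlog x hx]
      _ = _ := by
          rw [integral_add (integrable_const c) (integrable_finsetSum S hi),
            integral_finsetSum S hi]
          simp [integral_const_mul]
  rw [e μ hμ, e ν hν, hmass]
  exact add_le_add le_rfl (Finset.sum_le_sum fun r hr =>
    mul_le_mul_of_nonneg_left (h r ((hS r).1 hr)) (Nat.cast_nonneg _))

/-- Each `log |x - r|` lies below an integrable function `b r`, so the deficits `b r - log |x - r|`
are nonnegative and cannot cancel. As multiplicities are at least 1, one deficit is dominated by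
their weighted sum, which is integrable. -/
lemma HasOnlyRealRoots.integrable_log_sub_root (hQ : HasOnlyRealRoots Q)
    (hid : Integrable (fun x : ℝ => x) μ)
    (h : Integrable (fun x => Real.log (Polynomial.aeval x Q)) μ) {s : ℝ}
    (hs : Polynomial.aeval s Q = 0) : Integrable (fun x => Real.log (x - s)) μ := by
  obtain ⟨S, n, c, -, hS, hn, hlog⟩ := hQ.exists_log_eq
  set b : ℝ → ℝ → ℝ := fun r x => Real.log (1 + |x|) + Real.log (1 + |r|) with hb
  have hbi : ∀ r, Integrable (b r) μ := fun r =>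
    (integrable_log_one_add_abs hid).add (integrable_const _)
  have hbl : ∀ r x, 0 ≤ b r x - Real.log (x - r) := fun r x => sub_nonneg.2 (log_sub_le x r)
  have hdom : Integrable (fun x => ∑ r ∈ S, n r * b r x + c - Real.log (Polynomial.aeval x Q)) μ :=
    ((integrable_finsetSum S fun r _ => (hbi r).const_mul _).add (integrable_const c)).sub h
  have hd : Integrable (fun x => b s x - Real.log (x - s)) μ := by
    refine hdom.mono' ((hbi s).aestronglyMeasurable.sub
      (Real.measurable_log.comp (measurable_id.sub_const s)).aestronglyMeasurable) ?_
    filter_upwards [ae_notMem_finset μ S] with x hx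
    have hsS : s ∈ S := (hS s).2 hs
    have e : ∑ r ∈ S, n r * b r x + c - Real.log (Polynomial.aeval x Q)
        = ∑ r ∈ S, n r * (b r x - Real.log (x - r)) := by
      rw [hlog x hx]
      simp only [mul_sub, Finset.sum_sub_distrib]
      ring
    rw [Real.norm_of_nonneg (hbl s x), e]
    have h1 : (1 : ℝ) ≤ n s := by exact_mod_cast hn s hsS
    calc b s x - Real.log (x - s) ≤ n s * (b s x - Real.log (x - s)) :=
          le_mul_of_one_le_left (hbl s x) h1
      _ ≤ _ := Finset.single_le_sum (f := fun r => (n r : ℝ) * (b r x - Real.log (x - r)))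
          (fun r _ => mul_nonneg (Nat.cast_nonneg _) (hbl r x)) hsS
  refine ((hbi s).sub hd).congr (Filter.Eventually.of_forall fun x => ?_)
  simp

end Roots

/-! ### Feasibility and regularity of optimal measures -/

lemma isFeasible_of_integrable {A : Finset (Polynomial ℤ)} {ν : Measure ℝ}
    [IsProbabilityMeasure ν] [NullSingletonClass ν]
    (hA : ∀ Q ∈ A, HasOnlyRealRoots Q) (h0 : ν (Set.Iio 0) = 0)
    (hi : Integrable (fun z : ℝ × ℝ => Real.log (z.1 - z.2)) (ν.prod ν))
    (hI : 0 ≤ ∫ z, Real.log (z.1 - z.2) ∂(ν.prod ν))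
    (hQi : ∀ Q ∈ A, Integrable (fun x => Real.log (Polynomial.aeval x Q)) ν)
    (hQ : ∀ Q ∈ A, 0 ≤ ∫ x, Real.log (Polynomial.aeval x Q) ∂ν) : IsFeasible A ν where
  prob := inferInstance
  nonneg := h0
  energy := by
    rw [logEnergy, extIntegral_logAbs ae_sub_ne_zero hi]
    exact_mod_cast hI
  logs Q hQA := by
    obtain ⟨S, -, -, -, hS, -, -⟩ := (hA Q hQA).exists_log_eq
    -- `Real.log 0 = 0` while `logAbs 0 = ⊥`; the two integrals agree because the roots form a null
    -- set.
    have hne : ∀ᵐ x ∂ν, Polynomial.aeval x Q ≠ 0 := by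
      filter_upwards [ae_notMem_finset ν S] with x hx h
      exact hx ((hS x).2 h)
    rw [logIntegral, extIntegral_logAbs hne (hQi Q hQA)]
    exact_mod_cast hQ Q hQA

lemma mean_eq_ofReal {μ : Measure ℝ} (h0 : μ (Set.Iio 0) = 0)
    (hid : Integrable (fun x : ℝ => x) μ) : mean μ = ENNReal.ofReal (∫ x, x ∂μ) := by
  have : ∀ᵐ x ∂μ, 0 ≤ x := by
    filter_upwards [measure_eq_zero_iff_ae_notMem.1 h0] with x hx using not_lt.1 hx
  rw [mean, ofReal_integral_eq_lintegral_ofReal hid this]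

lemma unif_Iio_zero {p q : ℝ} (hp : 0 ≤ p) : unif p q (Set.Iio 0) = 0 := by
  rw [measure_eq_zero_iff_ae_notMem]
  filter_upwards [ae_unif] with x hx h
  exact absurd (Set.mem_Iio.1 h) (by linarith [hx.1])

lemma exists_isFeasible_mean_lt_top (A : Finset (Polynomial ℤ))
    (hA : ∀ Q ∈ A, HasOnlyRealRoots Q) : ∃ ν, IsFeasible A ν ∧ mean ν < ⊤ := by
  obtain ⟨L, hL, h⟩ := exists_le_integral_log_unif 0
  have := isProbabilityMeasure_unif hL
  have hid := integrable_id_unif hL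
  have hi := integrable_log_prod_unif hL hid
  have hr : ∀ r, Integrable (fun x => Real.log (x - r)) (unif 0 L) := fun r => by
    simpa only [log_sub_comm r] using integrable_log_sub_unif hL r
  refine ⟨unif 0 L, isFeasible_of_integrable hA (unif_Iio_zero le_rfl) hi ?_ ?_ ?_, ?_⟩
  · rw [integral_prod _ hi]
    exact integral_nonneg fun x => h x
  · exact fun Q hQ => (hA Q hQ).integrable_log fun r _ => hr r
  · refine fun Q hQ => (hA Q hQ).integral_log_nonneg (fun r _ => hr r) fun r _ => ?_
    simpa only [log_sub_comm r] using h r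
  · rw [mean_eq_ofReal (unif_Iio_zero le_rfl) hid]
    exact ENNReal.ofReal_lt_top

/-- The regularity properties of an optimal measure. -/
structure IsRegular (A : Finset (Polynomial ℤ)) (μ : Measure ℝ) : Prop where
  prob : IsProbabilityMeasure μ
  nullSingleton : NullSingletonClass μ
  nonneg : μ (Set.Iio 0) = 0
  integrable_id : Integrable (fun x : ℝ => x) μ
  integrable_log_prod : Integrable (fun z : ℝ × ℝ => Real.log (z.1 - z.2)) (μ.prod μ)
  energy : 0 ≤ ∫ z, Real.log (z.1 - z.2) ∂(μ.prod μ)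
  integrable_root : ∀ Q ∈ A, ∀ r, Polynomial.aeval r Q = 0 →
    Integrable (fun x => Real.log (x - r)) μ
  logs : ∀ Q ∈ A, 0 ≤ ∫ x, Real.log (Polynomial.aeval x Q) ∂μ

/-- A finite mean makes `log (1 + |x|)` integrable, which bounds every logarithm involved from
above. The sign constraints then force absolute convergence, and finite energy rules out atoms. -/
lemma IsFeasible.isRegular {A : Finset (Polynomial ℤ)} (hA : ∀ Q ∈ A, HasOnlyRealRoots Q)
    {μ : Measure ℝ} (hμ : IsFeasible A μ) (hm : mean μ < ⊤) : IsRegular A μ := by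
  have := hμ.prob
  have hid : Integrable (fun x : ℝ => x) μ := by
    refine ⟨measurable_id.aestronglyMeasurable, ?_⟩
    rw [hasFiniteIntegral_iff_norm]
    refine lt_of_eq_of_lt (lintegral_congr_ae ?_) hm
    filter_upwards [measure_eq_zero_iff_ae_notMem.1 hμ.nonneg] with x hx
    rw [Real.norm_of_nonneg (not_lt.1 hx)]
  have hlog := integrable_log_one_add_abs hid
  obtain ⟨hne, hi⟩ := integrable_log_of_extIntegral_nonneg
    (μ := μ.prod μ) (g := fun z : ℝ × ℝ => z.1 - z.2) (by fun_prop)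
    ((hlog.comp_fst μ).add (hlog.comp_snd μ))
    (Filter.Eventually.of_forall fun z => log_sub_le z.1 z.2) hμ.energy
  have hns := nullSingletonClass_of_ae_sub_ne_zero hne
  have hQ : ∀ Q ∈ A, (∀ᵐ x ∂μ, Polynomial.aeval x Q ≠ 0) ∧
      Integrable (fun x => Real.log (Polynomial.aeval x Q)) μ := fun Q hQA => by
    obtain ⟨S, n, c, -, -, -, hl⟩ := (hA Q hQA).exists_log_eq
    have hb : Integrable
        (fun x => c + ∑ r ∈ S, n r * (Real.log (1 + |x|) + Real.log (1 + |r|))) μ :=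
      (integrable_const c).add (integrable_finsetSum S fun r _ =>
        (hlog.add (integrable_const _)).const_mul _)
    refine integrable_log_of_extIntegral_nonneg (measurable_aeval Q) hb ?_ (hμ.logs Q hQA)
    filter_upwards [ae_notMem_finset μ S] with x hx
    rw [hl x hx]
    gcongr with r _
    exact log_sub_le x r
  refine ⟨hμ.prob, hns, hμ.nonneg, hid, hi, ?_, fun Q hQA r hr =>
    (hA Q hQA).integrable_log_sub_root hid (hQ Q hQA).2 hr, fun Q hQA => ?_⟩
  · have := hμ.energy
    rw [logEnergy, extIntegral_logAbs hne hi] at this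
    exact_mod_cast this
  · have := hμ.logs Q hQA
    rw [logIntegral, extIntegral_logAbs (hQ Q hQA).1 (hQ Q hQA).2] at this
    exact_mod_cast this

lemma IsOptimal.isRegular {A : Finset (Polynomial ℤ)} (hA : ∀ Q ∈ A, HasOnlyRealRoots Q)
    {μ : Measure ℝ} (hμ : IsOptimal A μ) : IsRegular A μ := by
  obtain ⟨ν, hν, hm⟩ := exists_isFeasible_mean_lt_top A hA
  exact hμ.1.isRegular hA ((hμ.2 ν hν).trans_lt hm)

/-! ### Mutual energy and the first-order perturbation argument -/

/-- The mutualEnergy logarithmic energy of two measures. -/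
noncomputable def mutualEnergy (α β : Measure ℝ) : ℝ := ∫ z, Real.log (z.1 - z.2) ∂(α.prod β)

/-- The mutualEnergy logarithmic energy converges absolutely. -/
def HasMutual (α β : Measure ℝ) : Prop :=
  Integrable (fun z : ℝ × ℝ => Real.log (z.1 - z.2)) (α.prod β)

lemma HasMutual.mono {α α' β β' : Measure ℝ} [IsFiniteMeasure β] (h : HasMutual α β)
    (h1 : α' ≤ α) (h2 : β' ≤ β) : HasMutual α' β' :=
  h.mono_measure (Measure.prod_mono h1 h2)

lemma HasMutual.smul_left {α β : Measure ℝ} [IsFiniteMeasure β] (h : HasMutual α β) (t : ℝ≥0) :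
    HasMutual (t • α) β := by
  rw [HasMutual, Measure.prod_smul_left]
  exact h.smul_measure_nnreal

section Mutual

variable {α β γ : Measure ℝ} [IsFiniteMeasure α] [IsFiniteMeasure β] [IsFiniteMeasure γ]

lemma mutualEnergy_comm (α β : Measure ℝ) [IsFiniteMeasure α] [IsFiniteMeasure β] :
    mutualEnergy α β = mutualEnergy β α := by
  rw [mutualEnergy, mutualEnergy, ← integral_prod_swap]
  simp only [Prod.fst_swap, Prod.snd_swap, log_sub_comm]

lemma HasMutual.symm (h : HasMutual α β) : HasMutual β α := by
  have := Integrable.swap h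
  refine this.congr (Filter.Eventually.of_forall fun z => ?_)
  simp [log_sub_comm]

lemma HasMutual.add_left (h : HasMutual α γ) (h' : HasMutual β γ) : HasMutual (α + β) γ := by
  rw [HasMutual, Measure.add_prod]
  exact h.add_measure h'

lemma mutualEnergy_add_smul_left (h : HasMutual α γ) (h' : HasMutual β γ) (t : ℝ≥0) :
    mutualEnergy (α + t • β) γ = mutualEnergy α γ + t * mutualEnergy β γ := by
  have h'' := h'.smul_left t
  rw [HasMutual, Measure.prod_smul_left] at h''
  rw [mutualEnergy, Measure.add_prod, Measure.prod_smul_left, integral_add_measure h h'',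
    integral_smul_nnreal_measure]
  rfl

lemma mutualEnergy_add_smul_right (h : HasMutual γ α) (h' : HasMutual γ β) (t : ℝ≥0) :
    mutualEnergy γ (α + t • β) = mutualEnergy γ α + t * mutualEnergy γ β := by
  rw [mutualEnergy_comm, mutualEnergy_add_smul_left h.symm h'.symm, mutualEnergy_comm α,
    mutualEnergy_comm β]

end Mutual

lemma exists_small (C : ℝ≥0) {Δ : ℝ} (hΔ : 0 < Δ) (c : ℝ) :
    ∃ t : ℝ≥0, 0 < t ∧ t * C ≤ 1 ∧ 0 ≤ 2 * Δ + t * c := by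
  have hc := abs_nonneg c
  have h1 : (0 : ℝ) < 1 / (C + 1) := by positivity
  have h2 : 0 < Δ / (|c| + 1) := by positivity
  refine ⟨⟨min (1 / (C + 1)) (Δ / (|c| + 1)), (lt_min h1 h2).le⟩, ?_, ?_, ?_⟩
  · exact_mod_cast lt_min h1 h2
  · rw [← NNReal.coe_le_coe]
    push_cast
    change min (1 / ((C : ℝ) + 1)) (Δ / (|c| + 1)) * C ≤ 1
    calc _ ≤ 1 / ((C : ℝ) + 1) * C := by gcongr; exact min_le_left _ _
      _ ≤ 1 := by
        rw [one_div, ← div_eq_inv_mul, div_le_one (by positivity)]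
        linarith
  · change 0 ≤ 2 * Δ + min (1 / ((C : ℝ) + 1)) (Δ / (|c| + 1)) * c
    have h3 : min (1 / ((C : ℝ) + 1)) (Δ / (|c| + 1)) * |c| ≤ Δ := by
      calc _ ≤ Δ / (|c| + 1) * |c| := by gcongr; exact min_le_right _ _
        _ ≤ Δ := by
          rw [div_mul_eq_mul_div, div_le_iff₀ (by positivity)]
          nlinarith
    have h4 := mul_le_mul_of_nonneg_left (neg_abs_le c) (lt_min h1 h2).le
    linarith

/-- An optimal measure `μ` cannot be improved by replacing a small multiple of a part `τ` of `μ`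
with the same multiple of another measure `ρ`. -/
theorem IsOptimal.not_improvable {A : Finset (Polynomial ℤ)} (hA : ∀ Q ∈ A, HasOnlyRealRoots Q)
    {μ : Measure ℝ} (hμ : IsOptimal A μ) {τ ρ : Measure ℝ} [IsFiniteMeasure τ] [IsFiniteMeasure ρ]
    [NullSingletonClass ρ] {C : ℝ≥0} (hτ : τ ≤ C • μ) (hmass : τ Set.univ = ρ Set.univ)
    (h0 : ρ (Set.Iio 0) = 0) (hid : Integrable (fun x : ℝ => x) ρ)
    (hμρ : HasMutual μ ρ) (hρρ : HasMutual ρ ρ)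
    (hroot : ∀ Q ∈ A, ∀ r, Polynomial.aeval r Q = 0 → Integrable (fun x => Real.log (x - r)) ρ)
    (hmean : ∫ x, x ∂ρ < ∫ x, x ∂τ) (henergy : mutualEnergy μ τ < mutualEnergy μ ρ)
    (hlog : ∀ Q ∈ A, ∀ r, Polynomial.aeval r Q = 0 →
      ∫ x, Real.log (x - r) ∂τ ≤ ∫ x, Real.log (x - r) ∂ρ) : False := by
  have hreg := hμ.isRegular hA
  have := hreg.prob
  have := hreg.nullSingleton
  have hμμ : HasMutual μ μ := hreg.integrable_log_prod
  have hmono : ∀ {f : ℝ → ℝ}, Integrable f μ → Integrable f τ := fun hf =>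
    (hf.smul_measure_nnreal (c := C)).mono_measure hτ
  have hτn : NullSingletonClass τ := ⟨fun x => by
    have := hτ {x}
    simpa using this⟩
  have hτμ : HasMutual τ μ := (hμμ.smul_left C).mono hτ le_rfl
  have hττ : HasMutual τ τ := (hτμ.symm.smul_left C).mono hτ le_rfl
  have hτρ : HasMutual τ ρ := (hμρ.smul_left C).mono hτ le_rfl
  -- `t * C ≤ 1` keeps `μ - tτ` a positive measure; the other bound lets the positive first-order
  -- gain in energy absorb the second-order term.
  obtain ⟨t, ht, htC, htΔ⟩ := exists_small C (sub_pos.2 henergy)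
    (mutualEnergy τ τ - 2 * mutualEnergy τ ρ + mutualEnergy ρ ρ)
  have ht' : (0 : ℝ) < t := ht
  have hle : t • τ ≤ μ := by
    intro s
    calc (t • τ) s = (t : ℝ≥0∞) * τ s := by
          rw [Measure.smul_apply, ENNReal.smul_def, smul_eq_mul]
      _ ≤ t * (C * μ s) := by
        gcongr
        have := hτ s
        rwa [Measure.smul_apply, ENNReal.smul_def, smul_eq_mul] at this
      _ = ((t * C : ℝ≥0) : ℝ≥0∞) * μ s := by push_cast; ring
      _ ≤ 1 * μ s := by gcongr; exact_mod_cast htC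
      _ = μ s := one_mul _
  -- Working with the common part `κ`, where `μ = κ + tτ` and `ν = κ + tρ`, avoids signed measures.
  set κ := μ - t • τ with hκ
  have hsum : κ + t • τ = μ := Measure.sub_add_cancel_of_le hle
  have hκμ : κ ≤ μ := Measure.sub_le
  have : IsFiniteMeasure κ := isFiniteMeasure_of_le μ hκμ
  have hκκ : HasMutual κ κ := hμμ.mono hκμ hκμ
  have hκτ : HasMutual κ τ := hτμ.symm.mono hκμ le_rfl
  have hκρ : HasMutual κ ρ := hμρ.mono hκμ le_rfl
  set ν := κ + t • ρ with hν
  have hfi : ∀ {f : ℝ → ℝ}, Integrable f μ → Integrable f ρ → Integrable f ν := fun h1 h2 =>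
    (h1.mono_measure hκμ).add_measure h2.smul_measure_nnreal
  have hf : ∀ {f : ℝ → ℝ}, Integrable f μ → Integrable f ρ →
      ∫ x, f x ∂ν = ∫ x, f x ∂μ + t * (∫ x, f x ∂ρ - ∫ x, f x ∂τ) := by
    intro f h1 h2
    have e1 : ∫ x, f x ∂μ = ∫ x, f x ∂κ + t * ∫ x, f x ∂τ := by
      conv_lhs => rw [← hsum]
      rw [integral_add_measure (h1.mono_measure hκμ) (hmono h1).smul_measure_nnreal,
        integral_smul_nnreal_measure]
      rfl
    have e2 : ∫ x, f x ∂ν = ∫ x, f x ∂κ + t * ∫ x, f x ∂ρ := by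
      rw [integral_add_measure (h1.mono_measure hκμ) h2.smul_measure_nnreal,
        integral_smul_nnreal_measure]
      rfl
    rw [e1, e2]
    ring
  have hνprob : IsProbabilityMeasure ν := by
    constructor
    rw [← hreg.prob.measure_univ, ← hsum]
    simp [hν, hmass]
  have hνn : NullSingletonClass ν := ⟨fun x => by
    have h1 : κ {x} = 0 := le_antisymm ((hκμ {x}).trans (by simp)) bot_le
    simp [hν, h1]⟩
  have hν0 : ν (Set.Iio 0) = 0 := by
    have h1 : κ (Set.Iio 0) = 0 := le_antisymm ((hκμ _).trans (by simp [hreg.nonneg])) bot_le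
    simp [hν, h1, h0]
  have hνν : HasMutual ν ν := by
    have h1 : HasMutual ν κ := hκκ.add_left (hκρ.symm.smul_left t)
    have h2 : HasMutual ν ρ := hκρ.add_left (hρρ.smul_left t)
    exact h1.symm.add_left (h2.symm.smul_left t)
  have hE : mutualEnergy ν ν = mutualEnergy μ μ + t * (2 * (mutualEnergy μ ρ - mutualEnergy μ τ)
      + t * (mutualEnergy τ τ - 2 * mutualEnergy τ ρ + mutualEnergy ρ ρ)) := by
    have e1 : mutualEnergy μ ρ = mutualEnergy κ ρ + t * mutualEnergy τ ρ := by
      conv_lhs => rw [← hsum]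
      exact mutualEnergy_add_smul_left hκρ hτρ t
    have e2 : mutualEnergy μ τ = mutualEnergy κ τ + t * mutualEnergy τ τ := by
      conv_lhs => rw [← hsum]
      exact mutualEnergy_add_smul_left hκτ hττ t
    have e3 : mutualEnergy μ μ = mutualEnergy μ κ + t * mutualEnergy μ τ := by
      have := mutualEnergy_add_smul_right (hμμ.mono le_rfl hκμ) hτμ.symm t
      rwa [hsum] at this
    have e4 : mutualEnergy μ κ = mutualEnergy κ κ + t * mutualEnergy τ κ := by
      conv_lhs => rw [← hsum]
      exact mutualEnergy_add_smul_left hκκ hκτ.symm t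
    have e5 : mutualEnergy ν ν = mutualEnergy ν κ + t * mutualEnergy ν ρ :=
      mutualEnergy_add_smul_right (hκκ.add_left (hκρ.symm.smul_left t))
        (hκρ.add_left (hρρ.smul_left t)) t
    have e6 : mutualEnergy ν κ = mutualEnergy κ κ + t * mutualEnergy ρ κ :=
      mutualEnergy_add_smul_left hκκ hκρ.symm t
    have e7 : mutualEnergy ν ρ = mutualEnergy κ ρ + t * mutualEnergy ρ ρ :=
      mutualEnergy_add_smul_left hκρ hρρ t
    rw [e5, e6, e7, e3, e4, e1, e2, mutualEnergy_comm τ κ, mutualEnergy_comm ρ κ]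
    ring
  have hlogi : ∀ Q ∈ A, Integrable (fun x => Real.log (Polynomial.aeval x Q)) ρ := fun Q hQ =>
    (hA Q hQ).integrable_log (hroot Q hQ)
  have hlogμ : ∀ Q ∈ A, Integrable (fun x => Real.log (Polynomial.aeval x Q)) μ := fun Q hQ =>
    (hA Q hQ).integrable_log (hreg.integrable_root Q hQ)
  have hfeas : IsFeasible A ν := by
    refine isFeasible_of_integrable hA hν0 hνν ?_ (fun Q hQ => hfi (hlogμ Q hQ) (hlogi Q hQ)) ?_
    · change 0 ≤ mutualEnergy ν ν
      rw [hE]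
      have := hreg.energy
      exact add_nonneg this (mul_nonneg ht'.le htΔ)
    · intro Q hQ
      rw [hf (hlogμ Q hQ) (hlogi Q hQ)]
      refine add_nonneg (hreg.logs Q hQ) (mul_nonneg ht'.le (sub_nonneg.2 ?_))
      refine (hA Q hQ).integral_log_mono (by simp [Measure.real, hmass])
        (fun r hr => hmono (hreg.integrable_root Q hQ r hr)) (hroot Q hQ) (hlog Q hQ)
  have hle := hμ.2 ν hfeas
  have hid' := hreg.integrable_id
  rw [mean_eq_ofReal hreg.nonneg hid', mean_eq_ofReal hν0 (hfi hid' hid), hf hid' hid] at hle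
  have hneg : t * (∫ x, x ∂ρ - ∫ x, x ∂τ) < 0 :=
    mul_neg_of_pos_of_neg ht' (sub_neg.2 hmean)
  -- `ENNReal.ofReal` truncates negative numbers, so the means can be compared as reals only once
  -- the new one is known to be nonnegative.
  have hρ0 : 0 ≤ ∫ x, x ∂ν := by
    refine integral_nonneg_of_ae ?_
    filter_upwards [measure_eq_zero_iff_ae_notMem.1 hν0] with x hx using not_lt.1 hx
  rw [hf hid' hid] at hρ0
  have := (ENNReal.ofReal_le_ofReal_iff hρ0).1 hle
  linarith

lemma integrable_log_sub_const_unif {p q : ℝ} (h : p < q) (r : ℝ) :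
    Integrable (fun x => Real.log (x - r)) (unif p q) := by
  simpa only [log_sub_comm r] using integrable_log_sub_unif h r

lemma mutualEnergy_smul_right {α β : Measure ℝ} [IsFiniteMeasure α] [IsFiniteMeasure β]
    (t : ℝ≥0) : mutualEnergy α (t • β) = t * mutualEnergy α β := by
  rw [mutualEnergy_comm, mutualEnergy_comm α, mutualEnergy, Measure.prod_smul_left,
    integral_smul_nnreal_measure]
  rfl

/-- An optimal measure `μ` cannot be improved by replacing a small multiple of a part `τ` of `μ`
with a uniform measure of the same mass. -/
lemma IsOptimal.not_improvable_unif {A : Finset (Polynomial ℤ)}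
    (hA : ∀ Q ∈ A, HasOnlyRealRoots Q) {μ : Measure ℝ} (hμ : IsOptimal A μ)
    {τ : Measure ℝ} [IsFiniteMeasure τ] {C k : ℝ≥0} {p q : ℝ} (hp : 0 ≤ p) (hpq : p < q)
    (hτ : τ ≤ C • μ) (hmass : τ Set.univ = k)
    (hmean : k * ∫ x, x ∂(unif p q) < ∫ x, x ∂τ)
    (henergy : mutualEnergy μ τ < k * mutualEnergy μ (unif p q))
    (hlog : ∀ Q ∈ A, ∀ r, Polynomial.aeval r Q = 0 →
      ∫ x, Real.log (x - r) ∂τ ≤ k * ∫ x, Real.log (x - r) ∂(unif p q)) : False := by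
  have hreg := hμ.isRegular hA
  have := hreg.prob
  have := isProbabilityMeasure_unif hpq
  have hid := integrable_id_unif hpq
  have hn : NullSingletonClass (k • unif p q) := ⟨fun x => by simp⟩
  have e : ∀ f : ℝ → ℝ, ∫ x, f x ∂(k • unif p q) = k * ∫ x, f x ∂(unif p q) := fun f => by
    rw [integral_smul_nnreal_measure]
    rfl
  have hμu : HasMutual μ (unif p q) := integrable_log_prod_unif hpq hreg.integrable_id
  have huu : HasMutual (unif p q) (unif p q) := integrable_log_prod_unif hpq hid
  have huk : HasMutual (unif p q) (k • unif p q) := (huu.smul_left k).symm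
  refine hμ.not_improvable hA (τ := τ) (ρ := k • unif p q) hτ ?_ ?_ hid.smul_measure_nnreal
    (hμu.symm.smul_left k).symm (huk.smul_left k)
    (fun Q _ r _ => (integrable_log_sub_const_unif hpq r).smul_measure_nnreal) ?_ ?_ ?_
  · rw [hmass, Measure.smul_apply, measure_univ, ENNReal.smul_def, smul_eq_mul, mul_one]
  · rw [Measure.smul_apply, unif_Iio_zero hp, smul_zero]
  · rwa [e]
  · rwa [mutualEnergy_smul_right]
  · intro Q hQ r hr
    rw [e]
    exact hlog Q hQ r hr

/-! ### Boundedness of the support -/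

lemma finite_roots {A : Finset (Polynomial ℤ)} (hA : ∀ Q ∈ A, HasOnlyRealRoots Q) :
    {r : ℝ | ∃ Q ∈ A, Polynomial.aeval r Q = 0}.Finite := by
  have : {r : ℝ | ∃ Q ∈ A, Polynomial.aeval r Q = 0}
      = ⋃ Q ∈ A, {r : ℝ | Polynomial.aeval r Q = 0} := by
    ext r
    simp
  rw [this]
  refine A.finite_toSet.biUnion fun Q hQ => ?_
  obtain ⟨S, -, -, -, hS, -, -⟩ := (hA Q hQ).exists_log_eq
  exact S.finite_toSet.subset fun r hr => (hS r).2 hr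

lemma exists_forall_log_le (a b : ℝ) :
    ∃ X, ∀ x, X < x → a * (b + Real.log (1 + |x|)) + 1 ≤ x := by
  have h1 : (fun x : ℝ => a * (b + Real.log (1 + x)) + 1) =o[Filter.atTop] (fun x : ℝ => x) := by
    have hl : (fun x : ℝ => Real.log (1 + x)) =o[Filter.atTop] (fun x : ℝ => x) := by
      have h2 : (fun x : ℝ => Real.log (1 + x)) =o[Filter.atTop] (fun x : ℝ => 1 + x) :=
        Real.isLittleO_log_id_atTop.comp_tendsto
          (Filter.tendsto_atTop_add_const_left _ 1 Filter.tendsto_id)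
      refine h2.trans_isBigO ?_
      exact ((Asymptotics.isLittleO_const_id_atTop (1 : ℝ)).isBigO).add
        (Asymptotics.isBigO_refl _ _)
    exact (((Asymptotics.isLittleO_const_id_atTop b).add hl).const_mul_left a).add
      (Asymptotics.isLittleO_const_id_atTop (1 : ℝ))
  have h2 := (h1.bound one_pos).and (Filter.eventually_ge_atTop 0)
  obtain ⟨X, hX⟩ := Filter.eventually_atTop.1 h2
  refine ⟨max X 0, fun x hx => ?_⟩
  have hx0 : 0 ≤ x := (le_max_right X 0).trans hx.le
  have := (hX x ((le_max_left X 0).trans hx.le)).1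
  rw [one_mul, Real.norm_eq_abs, Real.norm_eq_abs, abs_of_nonneg hx0] at this
  rw [abs_of_nonneg hx0]
  exact (le_abs_self _).trans this

/-- The tail `β` beyond `X` is replaced together with `K` copies of `μ`, where `K` bounds both its
mutual energy with `μ` and its integrals of `log |x - r|`. Since the potential of the uniform
measure exceeds by at least 1 the energy of `μ` and its potentials at the roots, moving the `K`
copies pays for this loss. The extra mass raises the mean by at most `K * L`, which is logarithmic
in the tail and so beaten by the mean of `β`. -/
theorem IsOptimal.exists_measure_Ioi_eq_zero {A : Finset (Polynomial ℤ)}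
    (hA : ∀ Q ∈ A, HasOnlyRealRoots Q) {μ : Measure ℝ} (hμ : IsOptimal A μ) :
    ∃ X, μ (Set.Ioi X) = 0 := by
  by_contra! hne
  have hreg := hμ.isRegular hA
  have := hreg.prob
  have hid := hreg.integrable_id
  have hlogi := integrable_log_one_add_abs hid
  have hR := finite_roots hA
  set R := {r : ℝ | ∃ Q ∈ A, Polynomial.aeval r Q = 0} with hRdef
  obtain ⟨N₀, hN₀⟩ := (hR.image fun r => ∫ x, Real.log (x - r) ∂μ).bddAbove
  obtain ⟨C₀, hC₀⟩ := (hR.image fun r => Real.log (1 + |r|)).bddAbove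
  set l := ∫ y, Real.log (1 + |y|) ∂μ with hl
  set N := max 1 (max (N₀ + 1) (mutualEnergy μ μ + 1)) with hN
  set C := max C₀ l with hC
  have hl0 : 0 ≤ l := integral_nonneg fun y => log_one_add_abs_nonneg y
  have hC0 : 0 ≤ C := hl0.trans (le_max_right _ _)
  have hN1 : 1 ≤ N := le_max_left _ _
  have hNN : N₀ + 1 ≤ N := (le_max_left _ _).trans (le_max_right _ _)
  have hNI : mutualEnergy μ μ + 1 ≤ N := (le_max_right _ _).trans (le_max_right _ _)
  obtain ⟨L, hL, hLN⟩ := exists_le_integral_log_unif N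
  have hu := isProbabilityMeasure_unif hL
  -- Integrated over `β`, this gives `(p + K) * L + p ≤ ∫ x ∂β`; the added 1 provides the strict
  -- decrease of the mean.
  obtain ⟨X, hX⟩ := exists_forall_log_le L (1 + C)
  set B := Set.Ioi X with hB
  set p : ℝ := μ.real B with hp
  have hp0 : 0 < p := ENNReal.toReal_pos (hne X) (measure_ne_top _ _)
  set β := μ.restrict B with hβ
  have hβμ : β ≤ μ := Measure.restrict_le_self
  have hβp : β.real Set.univ = p := by simp [hβ, hp]
  set a := ∫ x, Real.log (1 + |x|) ∂β with ha
  have ha0 : 0 ≤ a := integral_nonneg fun y => log_one_add_abs_nonneg y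
  have hlogβ : Integrable (fun x : ℝ => Real.log (1 + |x|)) β := hlogi.mono_measure hβμ
  set K : ℝ≥0 := ⟨a + p * C, by positivity⟩ with hK
  have hKa : (K : ℝ) = a + p * C := rfl
  set k : ℝ≥0 := (μ B).toNNReal + K with hk
  have hka : (k : ℝ) = p + K := rfl
  set τ := β + K • μ with hτ
  have hint : ∀ f : ℝ → ℝ, Integrable f μ → ∫ x, f x ∂τ = ∫ x, f x ∂β + K * ∫ x, f x ∂μ := by
    intro f hf
    rw [hτ, integral_add_measure (hf.mono_measure hβμ) hf.smul_measure_nnreal,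
      integral_smul_nnreal_measure]
    rfl
  refine hμ.not_improvable_unif hA (τ := τ) (C := 1 + K) (k := k) le_rfl hL ?_ ?_ ?_ ?_ ?_
  · rw [add_smul, one_smul]
    exact add_le_add hβμ le_rfl
  · rw [hτ, Measure.add_apply, Measure.smul_apply, measure_univ (μ := μ), ENNReal.smul_def,
      smul_eq_mul, mul_one, hβ, Measure.restrict_apply_univ, hk, ENNReal.coe_add,
      ENNReal.coe_toNNReal (measure_ne_top _ _)]
  · rw [hint _ hid]
    have h1 : ∫ x, (L * (1 + C + Real.log (1 + |x|)) + 1) ∂β ≤ ∫ x, x ∂β := by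
      refine integral_mono_ae (by fun_prop) (hid.mono_measure hβμ) ?_
      filter_upwards [ae_restrict_mem measurableSet_Ioi] with x hx using hX x hx
    rw [integral_add (by fun_prop) (by fun_prop), integral_const_mul,
      integral_add (by fun_prop) hlogβ] at h1
    simp only [integral_const, hβp, smul_eq_mul] at h1
    have h2 := integral_id_unif_le hL
    have h3 : 0 ≤ ∫ x, x ∂μ := by
      refine integral_nonneg_of_ae ?_
      filter_upwards [measure_eq_zero_iff_ae_notMem.1 hreg.nonneg] with x hx using not_lt.1 hx
    have h4 : 0 ≤ K * ∫ x, x ∂μ := mul_nonneg K.2 h3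
    have h5 : k * ∫ x, x ∂(unif 0 L) ≤ k * L := mul_le_mul_of_nonneg_left h2 k.2
    rw [hka, hKa] at h5
    nlinarith
  · have hμμ : HasMutual μ μ := hreg.integrable_log_prod
    have hμβ : HasMutual μ β := hμμ.mono le_rfl hβμ
    have hμu : HasMutual μ (unif 0 L) := integrable_log_prod_unif hL hid
    rw [hτ, mutualEnergy_add_smul_right hμβ hμμ]
    have h1 : mutualEnergy μ β ≤ p * l + a := by
      calc mutualEnergy μ β
          ≤ ∫ z, (Real.log (1 + |z.1|) + Real.log (1 + |z.2|)) ∂(μ.prod β) :=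
            integral_mono hμβ ((hlogi.comp_fst β).add (hlogβ.comp_snd μ))
              fun z => log_sub_le z.1 z.2
        _ = p * l + a := by
            rw [integral_add (hlogi.comp_fst β) (hlogβ.comp_snd μ), integral_fun_fst
              (fun x : ℝ => Real.log (1 + |x|)), integral_fun_snd
              (fun x : ℝ => Real.log (1 + |x|)), hβp]
            simp [hl, ha]
    have h2 : N ≤ mutualEnergy μ (unif 0 L) := by
      rw [mutualEnergy, integral_prod _ hμu]
      calc N = ∫ x, N ∂μ := by simp
        _ ≤ _ := integral_mono (integrable_const _) hμu.integral_prod_left hLN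
    have h3 : p * l ≤ p * C := mul_le_mul_of_nonneg_left (le_max_right _ _) hp0.le
    have h4 : K * mutualEnergy μ μ ≤ K * (N - 1) :=
      mul_le_mul_of_nonneg_left (by linarith) K.2
    have h5 : (k : ℝ) * N ≤ k * mutualEnergy μ (unif 0 L) := mul_le_mul_of_nonneg_left h2 k.2
    rw [hka] at h5 ⊢
    nlinarith
  · intro Q hQ r hr
    have hrR : r ∈ R := ⟨Q, hQ, hr⟩
    have hri := hreg.integrable_root Q hQ r hr
    rw [hint _ hri]
    have h0 : Real.log (1 + |r|) ≤ C := (hC₀ ⟨r, hrR, rfl⟩).trans (le_max_left _ _)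
    have h1 : ∫ x, Real.log (x - r) ∂β ≤ a + p * C := by
      calc ∫ x, Real.log (x - r) ∂β ≤ ∫ x, (Real.log (1 + |x|) + C) ∂β :=
            integral_mono (hri.mono_measure hβμ) (hlogβ.add (integrable_const _))
              fun x => (log_sub_le x r).trans (add_le_add le_rfl h0)
        _ = a + p * C := by
            rw [integral_add hlogβ (integrable_const _)]
            simp [hβp, ha]
    have h2 : N ≤ ∫ x, Real.log (x - r) ∂(unif 0 L) := by
      simpa only [log_sub_comm r] using hLN r
    have h3 : ∫ x, Real.log (x - r) ∂μ ≤ N - 1 := by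
      linarith [hN₀ ⟨r, hrR, rfl⟩]
    have h4 : K * ∫ x, Real.log (x - r) ∂μ ≤ K * (N - 1) := mul_le_mul_of_nonneg_left h3 K.2
    have h5 : (k : ℝ) * N ≤ k * ∫ x, Real.log (x - r) ∂(unif 0 L) :=
      mul_le_mul_of_nonneg_left h2 k.2
    rw [hka] at h5 ⊢
    nlinarith

/-! ### Truncated logarithms and potentials -/

/-- The truncation `max (log |u|) (log δ)` of the logarithm. -/
noncomputable def truncLog (δ u : ℝ) : ℝ := Real.log (max |u| δ)

section TruncLog

variable {δ : ℝ}

lemma log_le_truncLog {u : ℝ} (hu : u ≠ 0) : Real.log u ≤ truncLog δ u := by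
  rw [truncLog, ← Real.log_abs u]
  exact Real.log_le_log (abs_pos.2 hu) (le_max_left _ _)

lemma truncLog_eq {u : ℝ} (hu : δ ≤ |u|) : truncLog δ u = Real.log u := by
  rw [truncLog, max_eq_left hu, Real.log_abs]

lemma truncLog_sub_le (hδ : 0 < δ) (u v : ℝ) : truncLog δ u - truncLog δ v ≤ δ⁻¹ * |u - v| := by
  have hu : 0 < max |u| δ := lt_max_of_lt_right hδ
  have hv : 0 < max |v| δ := lt_max_of_lt_right hδ
  have h1 : |max |u| δ - max |v| δ| ≤ |u - v| :=
    (abs_max_sub_max_le_abs _ _ _).trans (abs_abs_sub_abs_le _ _)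
  rw [truncLog, truncLog, ← Real.log_div hu.ne' hv.ne']
  calc Real.log (max |u| δ / max |v| δ) ≤ max |u| δ / max |v| δ - 1 :=
        Real.log_le_sub_one_of_pos (div_pos hu hv)
    _ = (max |v| δ)⁻¹ * (max |u| δ - max |v| δ) := by field_simp
    _ ≤ (max |v| δ)⁻¹ * |u - v| := by gcongr; exact (le_abs_self _).trans h1
    _ ≤ δ⁻¹ * |u - v| := by gcongr; exact le_max_right _ _

lemma lipschitzWith_truncLog {δ : ℝ≥0} (hδ : 0 < δ) : LipschitzWith δ⁻¹ (truncLog δ) := by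
  refine LipschitzWith.of_dist_le_mul fun u v => ?_
  rw [Real.dist_eq, Real.dist_eq, NNReal.coe_inv, abs_le]
  have h1 := truncLog_sub_le (δ := δ) hδ u v
  have h2 := truncLog_sub_le (δ := δ) hδ v u
  rw [abs_sub_comm] at h2
  constructor <;> linarith

lemma integrable_of_lipschitzWith {K : ℝ≥0} {f : ℝ → ℝ} (hf : LipschitzWith K f)
    {α : Measure ℝ} [IsFiniteMeasure α] (hα : Integrable (fun x : ℝ => x) α) : Integrable f α := by
  have hb : Integrable (fun x => |f 0| + K * |x|) α :=
    (integrable_const _).add (hα.abs.const_mul _)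
  refine hb.mono' hf.continuous.aestronglyMeasurable (Filter.Eventually.of_forall fun x => ?_)
  have h := hf.dist_le_mul x 0
  rw [Real.dist_eq, Real.dist_eq, sub_zero] at h
  rw [Real.norm_eq_abs]
  calc |f x| = |f 0 + (f x - f 0)| := by ring_nf
    _ ≤ |f 0| + |f x - f 0| := abs_add_le _ _
    _ ≤ _ := by gcongr

/-- Exponentiated midpoint concavity with the pole at distance `d` from the nearer endpoint. For `d
≥ δ` it reads `d(d + 2h) < (d + h)²`; for `d < δ` the assumption `4δ ≤ h` leaves enough room. -/
lemma max_mul_max_lt {d h : ℝ} (hd : 0 ≤ d) (hδ : 0 < δ) (hδh : 4 * δ ≤ h) :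
    max d δ * (d + 2 * h) < (d + h) ^ 2 := by
  rcases max_cases d δ with ⟨h1, h2⟩ | ⟨h1, h2⟩ <;> rw [h1]
  · nlinarith
  · nlinarith

lemma truncLog_add_lt_of_nonneg {d h : ℝ} (hd : 0 ≤ d) (hδ : 0 < δ) (hδh : 4 * δ ≤ h) :
    truncLog δ d + truncLog δ (d + 2 * h) < 2 * truncLog δ (d + h) := by
  have h1 : |d| = d := abs_of_nonneg hd
  have h2 : |d + 2 * h| = d + 2 * h := abs_of_nonneg (by linarith)
  have h3 : |d + h| = d + h := abs_of_nonneg (by linarith)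
  have hm : 0 < max d δ := lt_max_of_lt_right hδ
  rw [truncLog, truncLog, truncLog, h1, h2, h3, max_eq_left (a := d + 2 * h) (by linarith),
    max_eq_left (a := d + h) (by linarith), ← Real.log_mul hm.ne' (by linarith)]
  have : 2 * Real.log (d + h) = Real.log ((d + h) ^ 2) := by
    rw [Real.log_pow]; norm_num
  rw [this]
  exact Real.log_lt_log (mul_pos hm (by linarith)) (max_mul_max_lt hd hδ hδh)

lemma truncLog_neg (u : ℝ) : truncLog δ (-u) = truncLog δ u := by rw [truncLog, truncLog, abs_neg]

/-- Strict concavity of the truncated logarithm across an interval which does not contain the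
pole. -/
lemma truncLog_add_lt {a b y : ℝ} (hδ : 0 < δ) (hδh : 8 * δ ≤ b - a)
    (hy : y ∉ Set.Ioo a b) :
    truncLog δ (a - y) + truncLog δ (b - y) < 2 * truncLog δ ((a + b) / 2 - y) := by
  rcases le_or_gt y a with h | h
  · have := truncLog_add_lt_of_nonneg (δ := δ) (d := a - y) (h := (b - a) / 2) (by linarith) hδ
      (by linarith)
    convert this using 3 <;> ring
  · have hb : b ≤ y := by
      by_contra! hb
      exact hy ⟨h, hb⟩
    have := truncLog_add_lt_of_nonneg (δ := δ) (d := y - b) (h := (b - a) / 2) (by linarith) hδ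
      (by linarith)
    rw [← truncLog_neg (a - y), ← truncLog_neg (b - y), ← truncLog_neg ((a + b) / 2 - y), add_comm]
    convert this using 3 <;> ring

end TruncLog

/-- The truncated logarithmic potential of `μ`. -/
noncomputable def truncPotential (μ : Measure ℝ) (δ x : ℝ) : ℝ := ∫ y, truncLog δ (x - y) ∂μ

section Potential

variable {μ : Measure ℝ} [IsProbabilityMeasure μ] {δ : ℝ≥0}

lemma lipschitzWith_truncLog_sub (hδ : 0 < δ) (y : ℝ) :
    LipschitzWith δ⁻¹ fun x => truncLog δ (x - y) := by
  refine LipschitzWith.of_dist_le_mul fun u v => ?_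
  simpa using (lipschitzWith_truncLog hδ).dist_le_mul (u - y) (v - y)

lemma integrable_truncLog_sub (hδ : 0 < δ) (hid : Integrable (fun x : ℝ => x) μ) (x : ℝ) :
    Integrable (fun y => truncLog δ (x - y)) μ := by
  have := integrable_of_lipschitzWith (lipschitzWith_truncLog_sub hδ x) hid
  refine this.congr (Filter.Eventually.of_forall fun y => ?_)
  change truncLog δ (y - x) = truncLog δ (x - y)
  rw [← truncLog_neg, neg_sub]

lemma lipschitzWith_truncPotential (hδ : 0 < δ) (hid : Integrable (fun x : ℝ => x) μ) :
    LipschitzWith δ⁻¹ (truncPotential μ δ) := by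
  refine LipschitzWith.of_dist_le_mul fun u v => ?_
  rw [Real.dist_eq, truncPotential, truncPotential,
    ← integral_sub (integrable_truncLog_sub hδ hid u) (integrable_truncLog_sub hδ hid v)]
  calc |∫ y, (truncLog δ (u - y) - truncLog δ (v - y)) ∂μ|
      ≤ ∫ y, |truncLog δ (u - y) - truncLog δ (v - y)| ∂μ := abs_integral_le_integral_abs
    _ ≤ ∫ y, ((δ⁻¹ : ℝ≥0) : ℝ) * dist u v ∂μ := by
        refine integral_mono ((integrable_truncLog_sub hδ hid u).sub
          (integrable_truncLog_sub hδ hid v)).abs (integrable_const _) fun y => ?_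
        have := (lipschitzWith_truncLog_sub hδ y).dist_le_mul u v
        rwa [Real.dist_eq] at this
    _ = _ := by simp

/-- The strict pointwise inequality holds for almost every `y`, since `μ` does not charge the gap,
and integration against a probability measure keeps it strict. -/
lemma truncPotential_add_lt (hδ : 0 < δ) (hid : Integrable (fun x : ℝ => x) μ) {a b : ℝ}
    (hδh : 8 * δ ≤ b - a) (hμ : μ (Set.Ioo a b) = 0) :
    truncPotential μ δ a + truncPotential μ δ b < 2 * truncPotential μ δ ((a + b) / 2) := by
  have ha := integrable_truncLog_sub hδ hid a
  have hb := integrable_truncLog_sub hδ hid b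
  have hc := (integrable_truncLog_sub hδ hid ((a + b) / 2)).const_mul 2
  have hab : Integrable (fun y => truncLog δ (a - y) + truncLog δ (b - y)) μ := ha.add hb
  rw [truncPotential, truncPotential, truncPotential, ← integral_add ha hb, ← integral_const_mul]
  have hae : ∀ᵐ y ∂μ, truncLog δ (a - y) + truncLog δ (b - y)
      < 2 * truncLog δ ((a + b) / 2 - y) := by
    filter_upwards [measure_eq_zero_iff_ae_notMem.1 hμ] with y hy
    exact truncLog_add_lt hδ hδh hy
  rw [← sub_pos, ← integral_sub hc hab, integral_pos_iff_support_of_nonneg_ae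
    (hae.mono fun y hy => (sub_pos.2 hy).le) (hc.sub hab)]
  have : Function.support (fun y => 2 * truncLog δ ((a + b) / 2 - y)
      - (truncLog δ (a - y) + truncLog δ (b - y))) =ᵐ[μ] Set.univ := by
    rw [Filter.eventuallyEq_univ]
    filter_upwards [hae] with y hy using (sub_pos.2 hy).ne'
  have h2 := measure_congr this
  rw [h2]
  simp

end Potential

/-! ### Gaps of the support contain roots -/

lemma eventually_separated {f : ℝ → ℝ} (hf : Continuous f) {a b c : ℝ} (h : f a + f b < 2 * f c) :
    ∀ᶠ s in nhdsWithin (0 : ℝ) (Set.Ioi 0), ∃ A B Z : ℝ, A + B < 2 * Z ∧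
      (∀ x ∈ Metric.closedBall a s, f x ≤ A) ∧ (∀ x ∈ Metric.closedBall b s, f x ≤ B) ∧
      ∀ x ∈ Metric.closedBall c (3 * s), Z ≤ f x := by
  -- The four errors of size `ε` use up only four fifths of the slack.
  set ε := (2 * f c - (f a + f b)) / 5 with hε
  have hε0 : 0 < ε := by simp only [hε]; linarith
  have key : ∀ z, ∃ η > 0, ∀ x, dist x z < η → |f x - f z| < ε := fun z =>
    Metric.continuous_iff.1 hf z ε hε0
  obtain ⟨η₁, h1, ha⟩ := key a
  obtain ⟨η₂, h2, hb⟩ := key b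
  obtain ⟨η₃, h3, hc⟩ := key c
  have hm : 0 < min η₁ (min η₂ (η₃ / 3)) := lt_min h1 (lt_min h2 (by linarith))
  filter_upwards [Ioo_mem_nhdsGT hm] with s hs
  have hs1 := (lt_min_iff.1 hs.2).1
  have hs2 := (lt_min_iff.1 (lt_min_iff.1 hs.2).2).1
  have hs3 := (lt_min_iff.1 (lt_min_iff.1 hs.2).2).2
  refine ⟨f a + ε, f b + ε, f c - ε, by linarith, fun x hx => ?_, fun x hx => ?_, fun x hx => ?_⟩
  · have := abs_lt.1 (ha x (lt_of_le_of_lt (Metric.mem_closedBall.1 hx) hs1))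
    linarith
  · have := abs_lt.1 (hb x (lt_of_le_of_lt (Metric.mem_closedBall.1 hx) hs2))
    linarith
  · have := abs_lt.1 (hc x (lt_of_le_of_lt (Metric.mem_closedBall.1 hx) (by linarith)))
    linarith

lemma integral_le_of_ae_mem {α : Measure ℝ} [IsProbabilityMeasure α] {f : ℝ → ℝ} {s : Set ℝ}
    {A : ℝ} (hf : Integrable f α) (hs : ∀ᵐ x ∂α, x ∈ s) (h : ∀ x ∈ s, f x ≤ A) :
    ∫ x, f x ∂α ≤ A := by
  calc ∫ x, f x ∂α ≤ ∫ x, A ∂α :=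
        integral_mono_ae hf (integrable_const _) (hs.mono fun x hx => h x hx)
    _ = A := by simp

lemma le_integral_of_ae_mem {α : Measure ℝ} [IsProbabilityMeasure α] {f : ℝ → ℝ} {s : Set ℝ}
    {A : ℝ} (hf : Integrable f α) (hs : ∀ᵐ x ∂α, x ∈ s) (h : ∀ x ∈ s, A ≤ f x) :
    A ≤ ∫ x, f x ∂α := by
  calc A = ∫ x, A ∂α := by simp
    _ ≤ _ := integral_mono_ae (integrable_const _) hf (hs.mono fun x hx => h x hx)

lemma cond_le_smul {μ : Measure ℝ} {s : Set ℝ} (hs : μ s ≠ 0) :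
    ProbabilityTheory.cond μ s ≤ ((μ s)⁻¹.toNNReal) • μ := by
  intro t
  rw [ProbabilityTheory.cond, Measure.smul_apply, Measure.smul_apply, ENNReal.smul_def,
    ENNReal.coe_toNNReal (ENNReal.inv_ne_top.2 hs)]
  exact mul_le_mul_right (Measure.restrict_apply_le _ _) _

/-- Truncation makes the potentials Lipschitz, so midpoint concavity at `a`, `b` and the midpoint
persists on small neighbourhoods. It only increases the logarithm at the mass removed and changes
nothing at the mass inserted, which is the direction needed. -/
theorem IsOptimal.exists_root_of_gap {A : Finset (Polynomial ℤ)}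
    (hA : ∀ Q ∈ A, HasOnlyRealRoots Q) {μ : Measure ℝ} (hμ : IsOptimal A μ) {a b : ℝ}
    (ha : a ∈ μ.support) (hb : b ∈ μ.support) (hab : a < b) (hgap : μ (Set.Ioo a b) = 0) :
    ∃ Q ∈ A, ∃ x ∈ Set.Ioo a b, Polynomial.aeval x Q = 0 := by
  by_contra! hno
  have hreg := hμ.isRegular hA
  have := hreg.prob
  have := hreg.nullSingleton
  have hid := hreg.integrable_id
  have ha0 : 0 ≤ a := by
    by_contra! h
    exact ((Measure.mem_support_iff_forall a).1 ha _ (Iio_mem_nhds h)).ne' hreg.nonneg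
  obtain ⟨δ, hδ0, hδ⟩ : ∃ δ : ℝ≥0, 0 < δ ∧ 8 * (δ : ℝ) = b - a :=
    ⟨((b - a) / 8).toNNReal, Real.toNNReal_pos.2 (by linarith), by
      rw [Real.coe_toNNReal _ (by linarith)]; ring⟩
  have hδ0' : (0 : ℝ) < δ := hδ0
  set c := (a + b) / 2 with hc
  have hRf := finite_roots hA
  set R := {r : ℝ | ∃ Q ∈ A, Polynomial.aeval r Q = 0} with hR
  have hRgap : ∀ r ∈ R, r ∉ Set.Ioo a b := by
    rintro r ⟨Q, hQ, hr⟩ hrm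
    exact hno Q hQ r hrm hr
  have hUL := lipschitzWith_truncPotential hδ0 hid
  have hU := eventually_separated hUL.continuous
    (truncPotential_add_lt hδ0 hid hδ.le hgap)
  -- Finiteness of the root set allows one radius `s` to serve all the roots and the potential at
  -- once.
  have hk := (Filter.eventually_all_finite hRf).2 fun r hr => eventually_separated
    (lipschitzWith_truncLog_sub hδ0 r).continuous
    (truncLog_add_lt hδ0' hδ.le (hRgap r hr))
  obtain ⟨s, ⟨hs0, hsδ⟩, hsU, hsk⟩ :=
    (Filter.Eventually.and (Ioo_mem_nhdsGT hδ0') (hU.and hk)).exists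
  have hpos : ∀ x ∈ μ.support, μ (Metric.closedBall x s) ≠ 0 := fun x hx =>
    ((Measure.mem_support_iff_forall x).1 hx _ (Metric.closedBall_mem_nhds x hs0)).ne'
  set α := ProbabilityTheory.cond μ (Metric.closedBall a s) with hα
  set β := ProbabilityTheory.cond μ (Metric.closedBall b s) with hβ
  have hαp : IsProbabilityMeasure α := ProbabilityTheory.cond_isProbabilityMeasure (hpos a ha)
  have hβp : IsProbabilityMeasure β := ProbabilityTheory.cond_isProbabilityMeasure (hpos b hb)
  have hαm : ∀ᵐ x ∂α, x ∈ Metric.closedBall a s :=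
    ProbabilityTheory.ae_cond_mem Metric.isClosed_closedBall.measurableSet
  have hβm : ∀ᵐ x ∂β, x ∈ Metric.closedBall b s :=
    ProbabilityTheory.ae_cond_mem Metric.isClosed_closedBall.measurableSet
  have hαμ := cond_le_smul (hpos a ha)
  have hβμ := cond_le_smul (hpos b hb)
  have hαi : ∀ {f : ℝ → ℝ}, Integrable f μ → Integrable f α := fun hf =>
    hf.smul_measure_nnreal.mono_measure hαμ
  have hβi : ∀ {f : ℝ → ℝ}, Integrable f μ → Integrable f β := fun hf =>
    hf.smul_measure_nnreal.mono_measure hβμ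
  have hτμ : α + β ≤ ((μ (Metric.closedBall a s))⁻¹.toNNReal
      + (μ (Metric.closedBall b s))⁻¹.toNNReal) • μ := by
    rw [add_smul]
    exact add_le_add hαμ hβμ
  -- The removed mass has mean at least `(a - s) + (b - s) = 2c - 2s`, while two units on `[c - 3s,
  -- c - 2s]` have mean at most `2c - 4s`.
  set p := c - 3 * s with hp
  set q := c - 2 * s with hq
  have hpq : p < q := by linarith
  have hu := isProbabilityMeasure_unif hpq
  have hidu := integrable_id_unif hpq
  have hum : ∀ᵐ x ∂(unif p q), x ∈ Metric.closedBall c (3 * s) := by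
    filter_upwards [ae_unif] with x hx
    rw [Metric.mem_closedBall, Real.dist_eq, abs_le]
    constructor <;> linarith [hx.1, hx.2]
  -- The midpoint is at distance `4δ` from both ends of the gap, and `3s < 3δ`.
  have hfar : ∀ x ∈ Set.Icc p q, ∀ y, y ∉ Set.Ioo a b → δ ≤ |x - y| := by
    intro x hx y hy
    rcases le_or_gt y a with h | h
    · exact le_trans (by linarith [hx.1]) (le_abs_self _)
    · have hyb : b ≤ y := by
        by_contra! hyb
        exact hy ⟨h, hyb⟩
      exact le_trans (by linarith [hx.2]) (neg_le_abs _)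
  have hcompare : ∀ {f : ℝ → ℝ}, LipschitzWith δ⁻¹ f → (∃ A B Z : ℝ, A + B < 2 * Z ∧
      (∀ x ∈ Metric.closedBall a s, f x ≤ A) ∧ (∀ x ∈ Metric.closedBall b s, f x ≤ B) ∧
      ∀ x ∈ Metric.closedBall c (3 * s), Z ≤ f x) →
      ∫ x, f x ∂(α + β) < 2 * ∫ x, f x ∂(unif p q) := by
    rintro f hf ⟨A', B', Z, hABZ, h1, h2, h3⟩
    have hfμ := integrable_of_lipschitzWith hf hid
    rw [integral_add_measure (hαi hfμ) (hβi hfμ)]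
    have e1 := integral_le_of_ae_mem (hαi hfμ) hαm h1
    have e2 := integral_le_of_ae_mem (hβi hfμ) hβm h2
    have e3 := le_integral_of_ae_mem (integrable_of_lipschitzWith hf hidu) hum h3
    linarith
  refine hμ.not_improvable_unif hA (τ := α + β) (k := 2) (by linarith) hpq hτμ ?_ ?_ ?_ ?_
  · rw [Measure.add_apply, measure_univ, measure_univ, one_add_one_eq_two]
    rfl
  · rw [integral_add_measure (hαi hid) (hβi hid), NNReal.coe_ofNat]
    have e1 : a - s ≤ ∫ x, x ∂α := le_integral_of_ae_mem (hαi hid) hαm fun x hx => by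
      rw [Metric.mem_closedBall, Real.dist_eq, abs_le] at hx
      linarith
    have e2 : b - s ≤ ∫ x, x ∂β := le_integral_of_ae_mem (hβi hid) hβm fun x hx => by
      rw [Metric.mem_closedBall, Real.dist_eq, abs_le] at hx
      linarith
    have e3 := integral_id_unif_le hpq
    linarith
  · have hμμ : HasMutual μ μ := hreg.integrable_log_prod
    have hτ : HasMutual (α + β) μ := (hμμ.smul_left _).mono hτμ le_rfl
    have hμu : HasMutual μ (unif p q) := integrable_log_prod_unif hpq hid
    have huμ := hμu.symm
    rw [mutualEnergy_comm μ, mutualEnergy_comm μ, NNReal.coe_ofNat]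
    have e1 : mutualEnergy (α + β) μ ≤ ∫ x, truncPotential μ δ x ∂(α + β) := by
      rw [mutualEnergy, integral_prod _ hτ]
      refine integral_mono_ae hτ.integral_prod_left
        (integrable_of_lipschitzWith hUL ((hαi hid).add_measure (hβi hid))) ?_
      filter_upwards [hτ.prod_right_ae] with x hx
      refine integral_mono_ae hx (integrable_truncLog_sub hδ0 hid x) ?_
      filter_upwards [Measure.ae_ne μ x] with y hy
      exact log_le_truncLog (sub_ne_zero.2 hy.symm)
    have e2 : mutualEnergy (unif p q) μ = ∫ x, truncPotential μ δ x ∂(unif p q) := by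
      rw [mutualEnergy, integral_prod _ huμ]
      refine integral_congr_ae ?_
      filter_upwards [ae_unif] with x hx
      refine integral_congr_ae ?_
      filter_upwards [measure_eq_zero_iff_ae_notMem.1 hgap] with y hy
      exact (truncLog_eq (hfar x hx y hy)).symm
    rw [e2]
    exact e1.trans_lt (hcompare hUL hsU)
  · intro Q hQ r hr
    have hrR : r ∈ R := ⟨Q, hQ, hr⟩
    have hri := hreg.integrable_root Q hQ r hr
    have hL := lipschitzWith_truncLog_sub hδ0 r
    rw [NNReal.coe_ofNat]
    have hnull : NullSingletonClass (α + β) := ⟨fun x => by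
      have := hτμ {x}
      simpa using this⟩
    have e1 : ∫ x, Real.log (x - r) ∂(α + β) ≤ ∫ x, truncLog δ (x - r) ∂(α + β) := by
      refine integral_mono_ae ((hαi hri).add_measure (hβi hri))
        (integrable_of_lipschitzWith hL ((hαi hid).add_measure (hβi hid))) ?_
      filter_upwards [Measure.ae_ne (α + β) r] with x hx
      exact log_le_truncLog (sub_ne_zero.2 hx)
    have e2 : ∫ x, Real.log (x - r) ∂(unif p q) = ∫ x, truncLog δ (x - r) ∂(unif p q) := by
      refine integral_congr_ae ?_
      filter_upwards [ae_unif] with x hx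
      exact (truncLog_eq (hfar x hx r (hRgap r hrR))).symm
    rw [e2]
    exact e1.trans (hcompare hL (hsk r hrR)).le

/-! ### Compact sets with finitely many gaps -/

lemma exists_gap {K : Set ℝ} (hK : IsCompact K) {x u v : ℝ} (hx : x ∉ K) (hu : u ∈ K)
    (hv : v ∈ K) (hux : u ≤ x) (hxv : x ≤ v) :
    ∃ a ∈ K, ∃ b ∈ K, a < x ∧ x < b ∧ (∀ y ∈ K, y ≤ x → y ≤ a) ∧ ∀ y ∈ K, x ≤ y → b ≤ y := by
  obtain ⟨a, ⟨haK, hax⟩, ha⟩ := (hK.inter_right isClosed_Iic).exists_isGreatest ⟨u, hu, hux⟩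
  obtain ⟨b, ⟨hbK, hbx⟩, hb⟩ := (hK.inter_right isClosed_Ici).exists_isLeast ⟨v, hv, hxv⟩
  refine ⟨a, haK, b, hbK, lt_of_le_of_ne hax fun h => hx (h ▸ haK),
    lt_of_le_of_ne hbx fun h => hx (h ▸ hbK), fun y hy h => ha ⟨hy, h⟩, fun y hy h => hb ⟨hy, h⟩⟩

/-- A compact set of reals without isolated points all of whose gaps meet a finite set is a finite
union of nondegenerate intervals. -/
theorem exists_eq_iUnion_Icc (F : Finset ℝ) : ∀ {K : Set ℝ}, IsCompact K → K.Nonempty →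
    (∀ x ∈ K, ∀ ε > 0, ∃ y ∈ K, y ≠ x ∧ |y - x| < ε) →
    (∀ a ∈ K, ∀ b ∈ K, a < b → (∀ x ∈ Set.Ioo a b, x ∉ K) → ∃ f ∈ F, f ∈ Set.Ioo a b) →
    ∃ (l : ℕ) (a : ℕ → ℝ), StrictMonoOn a (Set.Iic (2 * l + 1)) ∧
      K = ⋃ i ∈ Set.Iic l, Set.Icc (a (2 * i)) (a (2 * i + 1)) ∧
      (∀ i < l, ∃ f ∈ F, f ∈ Set.Ioo (a (2 * i + 1)) (a (2 * i + 2))) ∧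
      IsGreatest K (a (2 * l + 1)) := by
  induction F using Finset.strongInduction with
  | H F ih =>
    intro K hK hne hiso hgap
    obtain ⟨m, hmK, hm⟩ := hK.exists_isLeast hne
    obtain ⟨M, hMK, hM⟩ := hK.exists_isGreatest hne
    have hmeet : ∀ x ∉ K, ∀ u ∈ K, u ≤ x → x ≤ M → ∃ f ∈ F, f ∉ K ∧ u < f ∧ f < M := by
      intro x hx u hu hux hxM
      obtain ⟨a, haK, b, hbK, hax, hxb, ha, hb⟩ := exists_gap hK hx hu hMK hux hxM
      have hno : ∀ y ∈ Set.Ioo a b, y ∉ K := fun y hy hyK => by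
        rcases le_total y x with h | h
        · exact (ha y hyK h).not_gt hy.1
        · exact (hb y hyK h).not_gt hy.2
      obtain ⟨f, hf, hfab⟩ := hgap a haK b hbK (hax.trans hxb) hno
      exact ⟨f, hf, hno f hfab, (ha u hu hux).trans_lt hfab.1, hfab.2.trans_le (hM hbK)⟩
    classical
    by_cases hF : (F.filter fun f => f ∉ K ∧ m < f ∧ f < M).Nonempty
    -- The largest marked point missing from `K` lies in the rightmost gap, which is split off.
    · obtain ⟨f, hf, hfmax⟩ := Finset.exists_max_image _ id hF
      obtain ⟨hfF, hfK, hmf, hfM⟩ := Finset.mem_filter.1 hf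
      obtain ⟨a, haK, b, hbK, haf, hfb, ha, hb⟩ := exists_gap hK hfK hmK hMK hmf.le hfM.le
      -- `b` is not isolated in `K`, and `K` has no points in `(f, b)`.
      have hbM : b < M := by
        obtain ⟨y, hyK, hyb, hy⟩ := hiso b hbK (b - f) (by linarith)
        have h1 := hb y hyK (by linarith [(abs_lt.1 hy).1])
        exact (lt_of_le_of_ne h1 hyb.symm).trans_le (hM hyK)
      have hright : Set.Icc b M ⊆ K := by
        intro x hx
        by_contra hxK
        obtain ⟨g, hgF, hgK, hbg, hgM⟩ := hmeet x hxK b hbK hx.1 hx.2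
        have hmg : m < g := (hm hbK).trans_lt hbg
        have := hfmax g (Finset.mem_filter.2 ⟨hgF, hgK, hmg, hgM⟩)
        simp only [id] at this
        linarith
      have hmeetF : ∃ g ∈ F, g ∈ Set.Ioo a b := ⟨f, hfF, haf, hfb⟩
      -- Every gap of `K ∩ Iic f` ends at or before `f`, so the marked point inside it differs from
      -- `f` and erasing `f` is harmless.
      obtain ⟨l, A, hA, hKA, hgapA, hmaxA⟩ := ih (F.erase f) (Finset.erase_ssubset hfF)
        (K := K ∩ Set.Iic f) (hK.inter_right isClosed_Iic) ⟨a, haK, haf.le⟩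
        (by
          rintro x ⟨hxK, hxf⟩ ε hε
          have hxf' : x < f := lt_of_le_of_ne hxf fun h => hfK (h ▸ hxK)
          obtain ⟨y, hyK, hyx, hy⟩ := hiso x hxK (min ε (f - x)) (lt_min hε (by linarith))
          refine ⟨y, ⟨hyK, ?_⟩, hyx, hy.trans_le (min_le_left _ _)⟩
          have := (abs_lt.1 (hy.trans_le (min_le_right _ _))).2
          exact Set.mem_Iic.2 (by linarith))
        (by
          rintro u ⟨huK, huf⟩ v ⟨hvK, hvf⟩ huv hno
          have hvf' : v ≤ f := hvf
          obtain ⟨g, hgF, hg⟩ := hgap u huK v hvK huv fun x hx hxK =>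
            hno x hx ⟨hxK, (hx.2.le.trans hvf')⟩
          exact ⟨g, Finset.mem_erase.2 ⟨(hg.2.trans_le hvf').ne, hgF⟩, hg⟩)
      -- The `IsGreatest` clause of the induction identifies the last endpoint with the left end of
      -- the split-off gap.
      have hAa : A (2 * l + 1) = a := hmaxA.unique ⟨⟨haK, haf.le⟩, fun y hy => ha y hy.1 hy.2⟩
      set B : ℕ → ℝ := fun n => if n ≤ 2 * l + 1 then A n else if n = 2 * l + 2 then b else M
        with hB
      have hB1 : ∀ n ≤ 2 * l + 1, B n = A n := fun n hn => if_pos hn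
      have hB2 : B (2 * l + 2) = b := by simp [hB]
      have hB3 : B (2 * l + 3) = M := by simp [hB]
      refine ⟨l + 1, B, ?_, ?_, ?_, ?_⟩
      · intro i hi j hj hij
        rw [Set.mem_Iic] at hi hj
        have hle : ∀ n ≤ 2 * l + 1, B n ≤ a := fun n hn => by
          rw [hB1 n hn, ← hAa]
          exact hA.monotoneOn (Set.mem_Iic.2 hn) (Set.mem_Iic.2 le_rfl) hn
        rcases Nat.lt_or_ge (2 * l + 1) j with h | h
        · rcases (by omega : j = 2 * l + 2 ∨ j = 2 * l + 3) with rfl | rfl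
          · rw [hB2]
            exact (hle i (by omega)).trans_lt (haf.trans hfb)
          · rw [hB3]
            rcases Nat.lt_or_ge (2 * l + 1) i with h' | h'
            · rw [(by omega : i = 2 * l + 2), hB2]
              exact hbM
            · exact (hle i h').trans_lt ((haf.trans hfb).trans hbM)
        · rw [hB1 i (by omega), hB1 j h]
          exact hA (Set.mem_Iic.2 (by omega)) (Set.mem_Iic.2 h) hij
      · have hleft : K ∩ Set.Iic f = ⋃ i ∈ Set.Iic l, Set.Icc (B (2 * i)) (B (2 * i + 1)) := by
          rw [hKA]
          refine Set.iUnion₂_congr fun i hi => ?_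
          rw [Set.mem_Iic] at hi
          rw [hB1 _ (by omega), hB1 _ (by omega)]
        have hK2 : K = (K ∩ Set.Iic f) ∪ Set.Icc b M := by
          ext x
          constructor
          · intro hx
            rcases le_total x f with h | h
            · exact Or.inl ⟨hx, h⟩
            · exact Or.inr ⟨hb x hx h, hM hx⟩
          · rintro (hx | hx)
            · exact hx.1
            · exact hright hx
        have hlast : Set.Icc b M = Set.Icc (B (2 * (l + 1))) (B (2 * (l + 1) + 1)) := by
          rw [show 2 * (l + 1) + 1 = 2 * l + 3 by ring, show 2 * (l + 1) = 2 * l + 2 by ring,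
            hB2, hB3]
        have hIic : Set.Iic (l + 1) = insert (l + 1) (Set.Iic l) := by
          ext i
          simp only [Set.mem_Iic, Set.mem_insert_iff]
          omega
        rw [hIic, Set.biUnion_insert, ← hleft, ← hlast, Set.union_comm]
        exact hK2
      · intro i hi
        rcases Nat.lt_or_ge i l with h | h
        · obtain ⟨g, hgF, hg⟩ := hgapA i h
          refine ⟨g, Finset.mem_of_mem_erase hgF, ?_⟩
          rwa [hB1 _ (by omega), hB1 _ (by omega)]
        · rw [(by omega : i = l), hB1 _ le_rfl, hB2, hAa]
          exact hmeetF
      · rw [show 2 * (l + 1) + 1 = 2 * l + 3 by ring, hB3]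
        exact ⟨hMK, hM⟩
    · have hfull : K = Set.Icc m M := by
        refine Set.Subset.antisymm (fun x hx => ⟨hm hx, hM hx⟩) fun x hx => ?_
        by_contra hxK
        obtain ⟨f, hfF, hfK, h1, h2⟩ := hmeet x hxK m hmK hx.1 hx.2
        exact hF ⟨f, Finset.mem_filter.2 ⟨hfF, hfK, h1, h2⟩⟩
      have hmM : m < M := by
        obtain ⟨y, hyK, hym, -⟩ := hiso m hmK 1 one_pos
        exact (lt_of_le_of_ne (hm hyK) hym.symm).trans_le (hM hyK)
      refine ⟨0, fun n => if n = 0 then m else M, ?_, ?_, fun i hi => absurd hi (by omega), ?_⟩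
      · intro i hi j hj hij
        rw [Set.mem_Iic] at hi hj
        obtain rfl : i = 0 := by omega
        obtain rfl : j = 1 := by omega
        simpa using hmM
      · have hIic : Set.Iic 0 = ({0} : Set ℕ) := by
          ext i
          simp
        simpa [hIic] using hfull
      · change IsGreatest K M
        exact ⟨hMK, hM⟩

end TraceProblem

/-! ### Conclusion -/

theorem proposition2p7 (A : Finset (Polynomial ℤ))
    (hA : ∀ Q ∈ A, TraceProblem.HasOnlyRealRoots Q)
    (μ : MeasureTheory.Measure ℝ) (hμ : TraceProblem.IsOptimal A μ) :
    ∃ (l : ℕ) (a : ℕ → ℝ),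
      StrictMonoOn a (Set.Iic (2 * l + 1)) ∧
      μ.support = ⋃ i ∈ Set.Iic l, Set.Icc (a (2 * i)) (a (2 * i + 1)) ∧
      ∀ i < l, ∃ Q ∈ A, ∃ x ∈ Set.Ioo (a (2 * i + 1)) (a (2 * i + 2)),
        Polynomial.aeval x Q = 0 := by
  have hreg := hμ.isRegular hA
  have := hreg.prob
  have := hreg.nullSingleton
  have hfin := TraceProblem.finite_roots hA
  obtain ⟨X, hX⟩ := hμ.exists_measure_Ioi_eq_zero hA
  have hconull : ∀ᵐ x ∂μ, x ∈ μ.support := Measure.support_mem_ae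
  have hcompact : IsCompact μ.support := by
    refine isCompact_Icc.of_isClosed_subset Measure.isClosed_support (?_ : _ ⊆ Set.Icc 0 X)
    refine Measure.support_subset_of_isClosed isClosed_Icc ?_
    filter_upwards [measure_eq_zero_iff_ae_notMem.1 hX,
      measure_eq_zero_iff_ae_notMem.1 hreg.nonneg] with x h1 h2
    exact ⟨not_lt.1 h2, not_lt.1 h1⟩
  obtain ⟨l, a, ha, hsupp, hgap, -⟩ := TraceProblem.exists_eq_iUnion_Icc hfin.toFinset hcompact
    hconull.exists
    (by
      intro x hx ε hε
      -- An isolated point of the support would have a neighbourhood carrying at most an atom, hence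
      -- null.
      by_contra! h
      have h0 : μ (Metric.ball x ε) = 0 := by
        rw [measure_eq_zero_iff_ae_notMem]
        filter_upwards [hconull, Measure.ae_ne μ x] with y hy hyx hyb
        rw [Metric.mem_ball, Real.dist_eq] at hyb
        exact (h y hy hyx).not_gt hyb
      exact ((Measure.mem_support_iff_forall x).1 hx _ (Metric.ball_mem_nhds x hε)).ne' h0)
    (by
      intro u hu v hv huv hno
      have h0 : μ (Set.Ioo u v) = 0 := by
        rw [measure_eq_zero_iff_ae_notMem]
        filter_upwards [hconull] with y hy hyuv using hno y hyuv hy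
      obtain ⟨Q, hQ, x, hx, hxQ⟩ := hμ.exists_root_of_gap hA hu hv huv h0
      exact ⟨x, hfin.mem_toFinset.2 ⟨Q, hQ, hxQ⟩, hx⟩)
  refine ⟨l, a, ha, hsupp, fun i hi => ?_⟩
  obtain ⟨x, hx, hxi⟩ := hgap i hi
  obtain ⟨Q, hQ, hxQ⟩ := hfin.mem_toFinset.1 hx
  exact ⟨Q, hQ, x, hxi, hxQ⟩
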